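/- Setting. Let $\mathcal M$ be a regular matroid on a finite ground set $E$, represented over $\mathbb R$ by a totally unimodular matrix $M$ with columns indexed by $E$. An arc is one of the two vectors $\pm\mathbf 1_e\in\mathbb R^E$ with $e\in E$; a $\{0,\pm1\}$-vector is identified with the set of its arcs, and an orientation is a set of arcs in which each edge $e\in E$ appears exactly once. A signed circuit (resp. signed cocircuit) is a $\{0,\pm1\}$-vector in $\ker_{\mathbb R}(M)$ (resp. in $\operatorname{im}_{\mathbb R}(M^T)$) whose support is a circuit (resp. cocircuit) of $\mathcal M$. A circuit signature $\sigma$ (resp. cocircuit signature $\sigma^*$) is a set of signed circuits (resp. signed cocircuits) containing exactly one with support $C$ for each circuit (resp. cocircuit) $C$. An orientation is $\sigma$-compatible (resp. $\sigma^*$-compatible) if every signed circuit (resp. signed cocircuit) contained in it belongs to $\sigma$ (resp. $\sigma^*$), and $(\sigma,\sigma^*)$-compatible if it is both. For a basis $B$, let $\overrightarrow{B}$ be the set of arcs that contains both arcs of each $e\in B$ and, for each $e\notin B$, the arc of $e$ in the element of $\sigma$ supported on the fundamental circuit $C(B,e)$. Let $\overrightarrow{B^*}$ be the set of arcs that contains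 both arcs of each $e\notin B$ and, for each $e\in B$, the arc of $e$ in the element of $\sigma^*$ supported on the fundamental cocircuit $C^*(B,e)$. Put $\mathrm{BBY}_{\sigma,\sigma^*}(B)=\overrightarrow{B}\cap\overrightarrow{B^*}$. The signature $\sigma$ is triangulating if, for every basis $B$, each signed circuit contained in $\overrightarrow{B}$ belongs to $\sigma$; $\sigma^*$ is triangulating if, for every basis $B$, each signed cocircuit contained in $\overrightarrow{B^*}$ belongs to $\sigma^*$. Theorem. Suppose $\sigma$ and $\sigma^*$ are triangulating. Then $\mathrm{BBY}_{\sigma,\sigma^*}$ is a bijection from the bases of $\mathcal M$ to the $(\sigma,\sigma^*)$-compatible orientations. For every orientation $\overrightarrow{O}$ there is a unique $(\sigma,\sigma^*)$-compatible orientation $\overrightarrow{O^{cp}}$ that can be obtained from $\overrightarrow{O}$ by reversing pairwise disjoint signed circuits $\{\overrightarrow{C_i}\}_{i\in I}$ and signed cocircuits $\{\overrightarrow{C_j^*}\}_{j\in J}$ contained in $\overrightarrow{O}$. With $C_i$, $C_j^*$ denoting the supports, the set $$\varphi_{\sigma,\sigma^*}(\overrightarrow{O})=\Bigl(\mathrm{BBY}_{\sigma,\sigma^*}^{-1}(\overrightarrow{O^{cp}})\cup\biguplus_{i\in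 I}C_i\Bigr)\setminus\biguplus_{j\in J}C_j^*$$ does not depend on the choice of the reversed families, and the following hold. (1) $\varphi_{\sigma,\sigma^*}$ is a bijection from the set of orientations of $\mathcal M$ to the set of subsets of $E$. (2) $\varphi_{\sigma,\sigma^*}$ restricts to a bijection from the $\sigma$-compatible orientations to the independent sets of $\mathcal M$, and on these orientations $\varphi_{\sigma,\sigma^*}(\overrightarrow{O})=\mathrm{BBY}_{\sigma,\sigma^*}^{-1}(\overrightarrow{O^{cp}})\setminus\biguplus_{j\in J}C_j^*$. (3) $\varphi_{\sigma,\sigma^*}$ restricts to a bijection from the $\sigma^*$-compatible orientations to the spanning sets of $\mathcal M$, and on these orientations $\varphi_{\sigma,\sigma^*}(\overrightarrow{O})=\mathrm{BBY}_{\sigma,\sigma^*}^{-1}(\overrightarrow{O^{cp}})\cup\biguplus_{i\in I}C_i$. -/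

import Mathlib

open Set Matrix

namespace RegularMatroid

variable {E m : Type*} [Fintype E] [Fintype m]

/-- The real matrix `A` (columns indexed by the ground set `E`) is totally unimodular and
represents the matroid `M` on the ground set `E`: a set of edges is independent in `M` exactly when
the corresponding columns of `A` are linearly independent over `ℝ`. -/
structure IsTURepresentation (A : Matrix m E ℝ) (M : Matroid E) : Prop where
  totallyUnimodular : A.IsTotallyUnimodular
  ground_eq : M.E = Set.univ
  indep_iff : ∀ I : Set E, M.Indep I ↔ LinearIndepOn ℝ (fun e : E => fun i : m => A i e) I

/-- The arcs of the edge `e` are `(e, 1)` and `(e, -1)`; they stand for the vectors in `ℝ^E` whose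
`e`-th entry is `1`, resp. `-1`, and whose other entries are zero. -/
abbrev Arc (E : Type*) := E × ℤˣ

/-- The opposite arc. -/
def Arc.opp (a : Arc E) : Arc E := (a.1, -a.2)

/-- The underlying edges of a set of arcs. -/
def edges (F : Set (Arc E)) : Set E := Prod.fst '' F

/-- `-F`: the set of arcs obtained by reversing every arc of `F`. -/
def opp (F : Set (Arc E)) : Set (Arc E) := Arc.opp '' F

/-- A `{0, 1, -1}`-vector viewed as a set of arcs. -/
def arcsOf (v : E → ℝ) : Set (Arc E) := {a | v a.1 = ((a.2 : ℤ) : ℝ)}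

/-- Signed circuits, as sets of arcs: the `{0, 1, -1}`-vectors in `ker A` whose support is a circuit
of `M`. -/
def IsSignedCircuit (A : Matrix m E ℝ) (M : Matroid E) (C : Set (Arc E)) : Prop :=
  ∃ v : E → ℝ, (∀ e, v e = 0 ∨ v e = 1 ∨ v e = -1) ∧ A *ᵥ v = 0 ∧
    M.IsCircuit (Function.support v) ∧ C = arcsOf v

/-- Signed cocircuits, as sets of arcs: the `{0, 1, -1}`-vectors in `im Aᵀ` whose support is a
cocircuit of `M`. -/
def IsSignedCocircuit (A : Matrix m E ℝ) (M : Matroid E) (D : Set (Arc E)) : Prop :=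
  ∃ v : E → ℝ, (∀ e, v e = 0 ∨ v e = 1 ∨ v e = -1) ∧ (∃ y : m → ℝ, Aᵀ *ᵥ y = v) ∧
    M.IsCocircuit (Function.support v) ∧ D = arcsOf v

/-- An orientation: a set of arcs in which each edge appears exactly once. -/
def IsOrientation (O : Set (Arc E)) : Prop := ∀ e : E, ∃! s : ℤˣ, (e, s) ∈ O

/-- A circuit signature, viewed as the set of the chosen signed circuits: it consists of signed
circuits, exactly one for each circuit. -/
structure IsCircuitSignature (A : Matrix m E ℝ) (M : Matroid E) (σ : Set (Set (Arc E))) :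
    Prop where
  signed : ∀ C ∈ σ, IsSignedCircuit A M C
  existsUnique : ∀ X : Set E, M.IsCircuit X → ∃! C : Set (Arc E), C ∈ σ ∧ edges C = X

/-- A cocircuit signature, viewed as the set of the chosen signed cocircuits. -/
structure IsCocircuitSignature (A : Matrix m E ℝ) (M : Matroid E) (τ : Set (Set (Arc E))) :
    Prop where
  signed : ∀ D ∈ τ, IsSignedCocircuit A M D
  existsUnique : ∀ X : Set E, M.IsCocircuit X → ∃! D : Set (Arc E), D ∈ τ ∧ edges D = X

/-- The externally oriented basis of `B` in the external atlas of the circuit signature `σ`: edges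
of `B` are bioriented, and an edge `e ∉ B` is oriented as in the signed circuit chosen by `σ` for
the fundamental circuit of `e` with respect to `B`. -/
def extBasis (M : Matroid E) (σ : Set (Set (Arc E))) (B : Set E) : Set (Arc E) :=
  {a | a.1 ∈ B ∨ (a.1 ∉ B ∧ ∃ C ∈ σ, edges C = M.fundCircuit a.1 B ∧ a ∈ C)}

/-- The internally oriented basis of `B` in the internal atlas of the cocircuit signature `τ`: edges
outside `B` are bioriented, and an edge `e ∈ B` is oriented as in the signed cocircuit chosen by `τ`
for the fundamental cocircuit of `e` with respect to `B`. -/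
def intBasis (M : Matroid E) (τ : Set (Set (Arc E))) (B : Set E) : Set (Arc E) :=
  {a | a.1 ∉ B ∨ (a.1 ∈ B ∧ ∃ D ∈ τ, edges D = M.fundCocircuit a.1 B ∧ a ∈ D)}

/-- The circuit signature `σ` is triangulating: every signed circuit contained in an externally
oriented basis of its atlas belongs to `σ`. -/
def IsTriangulating (A : Matrix m E ℝ) (M : Matroid E) (σ : Set (Set (Arc E))) : Prop :=
  ∀ B, M.IsBase B → ∀ C, IsSignedCircuit A M C → C ⊆ extBasis M σ B → C ∈ σ

/-- The cocircuit signature `τ` is triangulating. -/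
def IsCoTriangulating (A : Matrix m E ℝ) (M : Matroid E) (τ : Set (Set (Arc E))) : Prop :=
  ∀ B, M.IsBase B → ∀ D, IsSignedCocircuit A M D → D ⊆ intBasis M τ B → D ∈ τ

/-- The BBY map of the pair `(σ, τ)`, on bases. -/
def bby (M : Matroid E) (σ τ : Set (Set (Arc E))) (B : Set E) : Set (Arc E) :=
  extBasis M σ B ∩ intBasis M τ B

/-- The `σ`-compatible orientations. -/
def compatible (A : Matrix m E ℝ) (M : Matroid E) (σ : Set (Set (Arc E))) : Set (Set (Arc E)) :=
  {O | IsOrientation O ∧ ∀ C, IsSignedCircuit A M C → C ⊆ O → C ∈ σ}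

/-- The orientations compatible with the cocircuit signature `τ`. -/
def coCompatible (A : Matrix m E ℝ) (M : Matroid E) (τ : Set (Set (Arc E))) : Set (Set (Arc E)) :=
  {O | IsOrientation O ∧ ∀ D, IsSignedCocircuit A M D → D ⊆ O → D ∈ τ}

/-- `O'` is obtained from `O` by reversing the disjoint signed circuits in `𝒞` and signed cocircuits
in `𝒟`, all of which are contained in `O`. -/
structure IsReversal (A : Matrix m E ℝ) (M : Matroid E) (O : Set (Arc E))
    (𝒞 𝒟 : Set (Set (Arc E))) (O' : Set (Arc E)) : Prop where
  circuit : ∀ C ∈ 𝒞, IsSignedCircuit A M C ∧ C ⊆ O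
  cocircuit : ∀ D ∈ 𝒟, IsSignedCocircuit A M D ∧ D ⊆ O
  disjoint_circuits : 𝒞.PairwiseDisjoint edges
  disjoint_cocircuits : 𝒟.PairwiseDisjoint edges
  disjoint_circuit_cocircuit : ∀ C ∈ 𝒞, ∀ D ∈ 𝒟, Disjoint (edges C) (edges D)
  eq : O' = (O \ (⋃₀ 𝒞 ∪ ⋃₀ 𝒟)) ∪ opp (⋃₀ 𝒞 ∪ ⋃₀ 𝒟)

/-- The data defining the extended map at the orientation `O`: a `(σ, τ)`-compatible orientation
`O'` obtained from `O` by reversing the disjoint families `𝒞`, `𝒟`, and a basis `B` mapped to `O'`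
by the BBY map. -/
structure IsExtensionData (A : Matrix m E ℝ) (M : Matroid E) (σ τ : Set (Set (Arc E)))
    (O : Set (Arc E)) (O' : Set (Arc E)) (𝒞 𝒟 : Set (Set (Arc E))) (B : Set E) : Prop where
  compatible : O' ∈ compatible A M σ ∩ coCompatible A M τ
  reversal : IsReversal A M O 𝒞 𝒟 O'
  isBase : M.IsBase B
  bby_eq : bby M σ τ B = O'

/-- The extended map: `O ↦ (B ∪ ⋃ 𝒞) \ ⋃ 𝒟` for data `O'`, `𝒞`, `𝒟`, `B` as above (a choice is made
here; that data exist and that the value does not depend on them is a matter of proof). -/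
noncomputable def extMap (A : Matrix m E ℝ) (M : Matroid E) (σ τ : Set (Set (Arc E)))
    (O : Set (Arc E)) : Set E :=
  Classical.epsilon fun S : Set E => ∃ O' 𝒞 𝒟 B, IsExtensionData A M σ τ O O' 𝒞 𝒟 B ∧
    S = (B ∪ edges (⋃₀ 𝒞)) \ edges (⋃₀ 𝒟)

end RegularMatroid

open RegularMatroid

open RegularMatroid

namespace RegularMatroid

/-! ### Arcs, orientations and sign vectors -/

section Arcs

variable {E : Type*}

/-! The integer vectors in the kernel and in the row space of `A` form orthogonal groups `V` and
`W`, and every circuit (cocircuit) supports a {0,1,-1}-vector of `V` (of `W`). This is `DualPair`.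
It is symmetric under matroid duality, so each cocircuit statement is the circuit statement for
`M✶`. Orthogonality and Minty's painting lemma `DualPair.painting` drive everything else.

BBY is injective: for two distinct bases with the same orientation, a suitable painting gives a
signed circuit in one externally oriented basis whose reverse lies in the other, or the dual
situation. Triangulation then puts both signings into one signature, which is absurd
(`DualPair.eq_of_agree`). BBY is onto by counting: deletion and contraction show that, for arbitrary
signatures, compatible orientations are at most as many as bases (`DualPair.ncard_compatible_le`).

Reversing disjoint circuits and cocircuits inside an orientation subtracts `2(u + v)` with `u ∈ V`,
`v ∈ W`. Conversely, orthogonality forces any two orientations with such a difference to be related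
by a reversal of this kind (`DualPair.isVectorReversal`). Hence reversal classes are classes of an
equivalence relation, and a class contains at most one compatible orientation. It contains at least
one: the lexicographic maxima of the classes are compatible with the signatures of positive vectors,
so there are at most as many classes as bases, while the compatible orientations are as many as
bases and lie in different classes.

The extended map is injective because its value determines `u`, `v`, then the basis, by the same
kind of argument (`DualPair.extension_injective`). Orientations and subsets of `E` are equinumerous,
so it is bijective. Compatibility with `σ` amounts to `u = 0`, and so does independence of the
value; dually `v = 0` corresponds to spanning. -/

@[simp] lemma Arc.opp_fst (a : Arc E) : a.opp.1 = a.1 := rfl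

@[simp] lemma Arc.opp_snd (a : Arc E) : a.opp.2 = -a.2 := rfl

@[simp] lemma Arc.opp_opp (a : Arc E) : a.opp.opp = a := by
  simp [Arc.opp]

lemma Arc.opp_ne (a : Arc E) : a.opp ≠ a := by
  obtain ⟨e, s⟩ := a
  rcases Int.units_eq_one_or s with rfl | rfl <;> simp [Arc.opp]

lemma Arc.eq_or_eq_opp {a b : Arc E} (h : a.1 = b.1) : a = b ∨ a = b.opp := by
  obtain ⟨e, s⟩ := a
  obtain ⟨f, t⟩ := b
  obtain rfl : e = f := h
  rcases Int.units_eq_one_or s with rfl | rfl <;> rcases Int.units_eq_one_or t with rfl | rfl <;>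
    simp [Arc.opp]

@[simp] lemma mem_opp {F : Set (Arc E)} {a : Arc E} : a ∈ opp F ↔ a.opp ∈ F := by
  constructor
  · rintro ⟨b, hb, rfl⟩
    simpa using hb
  · intro h
    exact ⟨_, h, by simp⟩

lemma mem_edges {F : Set (Arc E)} {e : E} : e ∈ edges F ↔ ∃ a ∈ F, a.1 = e := Iff.rfl

lemma fst_mem_edges {F : Set (Arc E)} {a : Arc E} (h : a ∈ F) : a.1 ∈ edges F := ⟨a, h, rfl⟩

lemma opp_subset_iff {F G : Set (Arc E)} : opp F ⊆ G ↔ F ⊆ opp G := by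
  constructor
  · intro h a ha
    rw [mem_opp]
    exact h (by simpa using ha)
  · intro h a ha
    simpa using h (mem_opp.1 ha)

@[simp] lemma edges_opp (F : Set (Arc E)) : edges (opp F) = edges F := by
  ext e
  constructor
  · rintro ⟨a, ha, rfl⟩
    exact ⟨Arc.opp a, mem_opp.1 ha, rfl⟩
  · rintro ⟨a, ha, rfl⟩
    exact ⟨Arc.opp a, by simpa using ha, rfl⟩

lemma isOrientation_iff {O : Set (Arc E)} : IsOrientation O ↔ ∀ a : Arc E, a ∈ O ↔ a.opp ∉ O := by
  constructor
  · intro h a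
    obtain ⟨s, hs, hu⟩ := h a.1
    have key : ∀ b : Arc E, b.1 = a.1 → b ∈ O → b = (a.1, s) := by
      intro b hb hbO
      refine Prod.ext hb (hu b.2 ?_)
      rw [← hb]
      exact hbO
    constructor
    · intro h1 h2
      have := key a rfl h1
      have h3 := key a.opp rfl h2
      exact a.opp_ne (h3.trans this.symm)
    · intro h1
      rcases Arc.eq_or_eq_opp (a := a) (b := (a.1, s)) rfl with h2 | h2
      · rw [h2]
        exact hs
      · exfalso
        apply h1
        rw [h2]
        simpa using hs
  · intro h e
    by_cases h1 : ((e, 1) : Arc E) ∈ O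
    · refine ⟨1, h1, ?_⟩
      intro s hs
      rcases Int.units_eq_one_or s with rfl | rfl
      · rfl
      · exact absurd hs ((h (e, 1)).1 h1)
    · refine ⟨-1, (h (e, -1)).2 (by simpa [Arc.opp] using h1), ?_⟩
      intro s hs
      rcases Int.units_eq_one_or s with rfl | rfl
      · exact absurd hs h1
      · rfl

/-- The arcs along which an integer vector takes the value `1`. -/
def signedArcs (v : E → ℤ) : Set (Arc E) := {a | v a.1 = a.2}

lemma mem_signedArcs {v : E → ℤ} {a : Arc E} : a ∈ signedArcs v ↔ v a.1 = a.2 := Iff.rfl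

/-- The vectors with entries in `{0, 1, -1}`. -/
def IsSignVector (v : E → ℤ) : Prop := ∀ e, v e = 0 ∨ v e = 1 ∨ v e = -1

lemma unit_int_cases (s : ℤˣ) : (s : ℤ) = 1 ∨ (s : ℤ) = -1 := by
  rcases Int.units_eq_one_or s with rfl | rfl <;> simp

lemma IsSignVector.neg {v : E → ℤ} (h : IsSignVector v) : IsSignVector (-v) := by
  intro e
  rcases h e with h | h | h <;> simp [h]

lemma opp_signedArcs (v : E → ℤ) : opp (signedArcs v) = signedArcs (-v) := by
  ext a
  simp only [mem_opp, mem_signedArcs, Arc.opp_fst, Arc.opp_snd, Pi.neg_apply, Units.val_neg]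
  omega

lemma edges_signedArcs {v : E → ℤ} (h : IsSignVector v) :
    edges (signedArcs v) = Function.support v := by
  ext e
  simp only [mem_edges, mem_signedArcs, Function.mem_support]
  constructor
  · rintro ⟨a, ha, rfl⟩
    rcases unit_int_cases a.2 with h | h <;> omega
  · intro he
    rcases h e with h | h | h
    · exact absurd h he
    · exact ⟨(e, 1), by simpa using h, rfl⟩
    · exact ⟨(e, -1), by simpa using h, rfl⟩

open Classical in
/-- The vector of a set of arcs: the sum of the signed unit vectors of its arcs. -/
noncomputable def vec (F : Set (Arc E)) : E → ℤ :=
  fun e => (if ((e, 1) : Arc E) ∈ F then 1 else 0) - (if ((e, -1) : Arc E) ∈ F then 1 else 0)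

lemma vec_signedArcs {v : E → ℤ} (h : IsSignVector v) : vec (signedArcs v) = v := by
  ext e
  simp only [vec, mem_signedArcs]
  rcases h e with h | h | h <;> simp [h]

lemma vec_opp (F : Set (Arc E)) : vec (opp F) = -vec F := by
  ext e
  have h1 : ((e, 1) : Arc E) ∈ opp F ↔ ((e, -1) : Arc E) ∈ F := mem_opp
  have h2 : ((e, -1) : Arc E) ∈ opp F ↔ ((e, 1) : Arc E) ∈ F := by simp [mem_opp, Arc.opp]
  simp only [vec, Pi.neg_apply]
  by_cases h3 : ((e, 1) : Arc E) ∈ F <;> by_cases h4 : ((e, -1) : Arc E) ∈ F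
  all_goals
    have h5 := h1.trans (iff_of_eq (by first | exact eq_true h4 | exact eq_false h4))
    have h6 := h2.trans (iff_of_eq (by first | exact eq_true h3 | exact eq_false h3))
    simp [h3, h4, h5, h6]

lemma vec_apply_of_mem {F : Set (Arc E)} {a : Arc E} (h : a ∈ F) (h' : a.opp ∉ F) :
    vec F a.1 = a.2 := by
  obtain ⟨e, s⟩ := a
  rcases Int.units_eq_one_or s with rfl | rfl
  · have h'' : ((e, -1) : Arc E) ∉ F := h'
    simp [vec, h, h'']
  · have h'' : ((e, 1) : Arc E) ∉ F := by simpa [Arc.opp] using h'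
    simp [vec, h, h'']

lemma vec_apply_of_notMem {F : Set (Arc E)} {e : E} (h : e ∉ edges F) : vec F e = 0 := by
  have h1 : ((e, 1) : Arc E) ∉ F := fun h' => h (fst_mem_edges h')
  have h2 : ((e, -1) : Arc E) ∉ F := fun h' => h (fst_mem_edges h')
  simp [vec, h1, h2]

lemma IsOrientation.vec_eq_iff {O : Set (Arc E)} (h : IsOrientation O) (a : Arc E) :
    vec O a.1 = a.2 ↔ a ∈ O := by
  rw [isOrientation_iff] at h
  constructor
  · intro h1
    by_contra h2
    have h3 : a.opp ∈ O := by
      by_contra h3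
      exact h2 ((h a).2 h3)
    have := vec_apply_of_mem h3 (by simpa using h2)
    simp only [Arc.opp_fst, Arc.opp_snd, Units.val_neg] at this
    rcases unit_int_cases a.2 with h | h <;> omega
  · intro h1
    exact vec_apply_of_mem h1 ((h a).1 h1)

lemma IsOrientation.signedArcs_vec {O : Set (Arc E)} (h : IsOrientation O) :
    signedArcs (vec O) = O := by
  ext a
  exact h.vec_eq_iff a

lemma IsOrientation.vec_cases {O : Set (Arc E)} (h : IsOrientation O) (e : E) :
    vec O e = 1 ∨ vec O e = -1 := by
  obtain ⟨s, hs, -⟩ := h e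
  have := (h.vec_eq_iff (e, s)).2 hs
  rcases unit_int_cases s with h | h
  · left; simpa [h] using this
  · right; simpa [h] using this

lemma IsOrientation.opp_mem {O : Set (Arc E)} (h : IsOrientation O) {a : Arc E} (ha : a ∉ O) :
    a.opp ∈ O := by
  by_contra h'
  exact ha ((isOrientation_iff.1 h a).2 h')

lemma IsOrientation.opp_notMem {O : Set (Arc E)} (h : IsOrientation O) {a : Arc E} (ha : a ∈ O) :
    a.opp ∉ O :=
  (isOrientation_iff.1 h a).1 ha

lemma isOrientation_signedArcs {v : E → ℤ} (h : ∀ e, v e = 1 ∨ v e = -1) :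
    IsOrientation (signedArcs v) := by
  rw [isOrientation_iff]
  intro a
  simp only [mem_signedArcs, Arc.opp_fst, Arc.opp_snd, Units.val_neg]
  rcases h a.1 with h | h <;> rcases unit_int_cases a.2 with h' | h' <;> rw [h, h'] <;> norm_num

end Arcs

/-! ### Orthogonality, the painting lemma and conformal decomposition -/

section SignedCircuits

variable {E : Type*}

/-- The signed circuits of `M` in a group `V` of integer vectors. -/
def IsSignedIn (V : AddSubgroup (E → ℤ)) (M : Matroid E) (C : Set (Arc E)) : Prop :=
  ∃ v ∈ V, IsSignVector v ∧ M.IsCircuit (Function.support v) ∧ C = signedArcs v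

variable {V W : AddSubgroup (E → ℤ)} {M : Matroid E} {C D : Set (Arc E)}

lemma IsSignedIn.isCircuit (h : IsSignedIn V M C) : M.IsCircuit (edges C) := by
  obtain ⟨v, hv, hs, hc, rfl⟩ := h
  rwa [edges_signedArcs hs]

lemma IsSignedIn.vec_mem (h : IsSignedIn V M C) : vec C ∈ V := by
  obtain ⟨v, hv, hs, hc, rfl⟩ := h
  rwa [vec_signedArcs hs]

lemma IsSignedIn.isSignVector_vec (h : IsSignedIn V M C) : IsSignVector (vec C) := by
  obtain ⟨v, hv, hs, hc, rfl⟩ := h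
  rwa [vec_signedArcs hs]

lemma IsSignedIn.signedArcs_vec (h : IsSignedIn V M C) : signedArcs (vec C) = C := by
  obtain ⟨v, hv, hs, hc, rfl⟩ := h
  rw [vec_signedArcs hs]

lemma IsSignedIn.opp (h : IsSignedIn V M C) : IsSignedIn V M (opp C) := by
  obtain ⟨v, hv, hs, hc, rfl⟩ := h
  refine ⟨-v, V.neg_mem hv, hs.neg, ?_, opp_signedArcs v⟩
  rwa [Function.support_neg]

lemma IsSignedIn.opp_notMem (h : IsSignedIn V M C) {a : Arc E} (ha : a ∈ C) : a.opp ∉ C := by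
  obtain ⟨v, hv, hs, hc, rfl⟩ := h
  simp only [mem_signedArcs, Arc.opp_fst, Arc.opp_snd, Units.val_neg] at ha ⊢
  rcases unit_int_cases a.2 with h | h <;> omega

lemma IsSignedIn.nonempty (h : IsSignedIn V M C) : C.Nonempty := by
  obtain ⟨e, a, ha, -⟩ := h.isCircuit.nonempty
  exact ⟨a, ha⟩

lemma IsSignedIn.ne_opp (h : IsSignedIn V M C) : RegularMatroid.opp C ≠ C := by
  intro h'
  obtain ⟨a, ha⟩ := h.nonempty
  apply h.opp_notMem ha
  rw [← mem_opp, h']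
  exact ha

lemma IsSignedIn.mem_or_opp_mem {a : Arc E} (ha : a.1 ∈ edges C) : a ∈ C ∨ a.opp ∈ C := by
  obtain ⟨b, hb, hab⟩ := ha
  rcases Arc.eq_or_eq_opp hab with rfl | rfl
  · exact Or.inl hb
  · exact Or.inr hb

/-- The unsigned painting lemma. If `e` is not spanned by `P`, extend a basis of `P` together with
`e` to a base `B`; the complement of the hyperplane spanned by `B \ {e}` is the cocircuit. -/
lemma exists_isCircuit_or_isCocircuit (hM : M.E = univ) {e : E} {P : Set E} (he : e ∉ P) :
    (∃ X ⊆ insert e P, M.IsCircuit X ∧ e ∈ X) ∨ (∃ X, M✶.IsCircuit X ∧ e ∈ X ∧ Disjoint X P) := by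
  by_cases hcl : e ∈ M.closure P
  · exact Or.inl (Matroid.exists_isCircuit_of_mem_closure hcl he)
  · right
    obtain ⟨I, hI⟩ := M.exists_isBasis P (by simp [hM])
    have heI : e ∉ M.closure I := by rwa [hI.closure_eq_closure]
    have hind : M.Indep (insert e I) := by
      rw [hI.indep.insert_indep_iff]
      exact Or.inl ⟨by simp [hM], heI⟩
    obtain ⟨B, hB, hIB⟩ := hind.exists_isBase_superset
    have heB : e ∈ B := hIB (mem_insert _ _)
    refine ⟨_, hB.compl_closure_sdiff_singleton_isCocircuit heB, ⟨by simp [hM], ?_⟩, ?_⟩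
    · exact hB.indep.notMem_closure_sdiff_of_mem heB
    · rw [Set.disjoint_left]
      intro f hf hfP
      apply hf.2
      have h1 : P ⊆ M.closure I := hI.subset_closure
      refine M.closure_subset_closure ?_ (h1 hfP)
      intro x hx
      refine ⟨hIB (mem_insert_of_mem _ hx), ?_⟩
      rintro rfl
      exact he (hI.subset hx)

/-- A matroid whose circuits and cocircuits are signed by two orthogonal groups of vectors. -/
structure DualPair [Fintype E] (M : Matroid E) (V W : AddSubgroup (E → ℤ)) : Prop where
  ground_eq : M.E = univ
  orthogonal : ∀ v ∈ V, ∀ w ∈ W, ∑ e, v e * w e = 0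
  exists_circuit : ∀ X, M.IsCircuit X → ∃ C, IsSignedIn V M C ∧ edges C = X
  exists_cocircuit : ∀ X, M✶.IsCircuit X → ∃ D, IsSignedIn W M✶ D ∧ edges D = X

variable [Fintype E]

lemma DualPair.symm (h : DualPair M V W) : DualPair M✶ W V where
  ground_eq := h.ground_eq
  orthogonal := by
    intro v hv w hw
    simpa [mul_comm] using h.orthogonal w hw v hv
  exists_circuit := h.exists_cocircuit
  exists_cocircuit := by simpa using h.exists_circuit

/-- A vanishing sum with a positive term has a negative term. -/
lemma DualPair.exists_opp_mem_of_vec (h : DualPair M V W) {v : E → ℤ} (hv : v ∈ V)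
    (hD : IsSignedIn W M✶ D) {a : Arc E} (ha : 0 < v a.1 * a.2) (haD : a ∈ D) :
    ∃ b ∈ D, v b.1 * b.2 < 0 := by
  obtain ⟨w, hw, hs, hc, rfl⟩ := hD
  by_contra! hb
  have h0 := h.orthogonal v hv w hw
  have hnn : ∀ e ∈ Finset.univ, 0 ≤ v e * w e := by
    intro e _
    rcases hs e with h1 | h1 | h1
    · simp [h1]
    · simpa [h1] using hb (e, 1) (by simpa [mem_signedArcs] using h1)
    · simpa [h1] using hb (e, -1) (by simpa [mem_signedArcs] using h1)
  have := (Finset.sum_eq_zero_iff_of_nonneg hnn).1 h0 a.1 (Finset.mem_univ _)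
  rw [mem_signedArcs] at haD
  rw [haD] at this
  omega

lemma DualPair.exists_opp_mem (h : DualPair M V W) (hC : IsSignedIn V M C)
    (hD : IsSignedIn W M✶ D) {a : Arc E} (haC : a ∈ C) (haD : a ∈ D) :
    ∃ b ∈ D, b.opp ∈ C := by
  have h1 : vec C a.1 * a.2 = 1 := by
    rw [vec_apply_of_mem haC (hC.opp_notMem haC)]
    rcases unit_int_cases a.2 with h | h <;> simp [h]
  obtain ⟨b, hb, hlt⟩ := h.exists_opp_mem_of_vec hC.vec_mem hD (a := a) (by omega) haD
  refine ⟨b, hb, ?_⟩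
  rw [← hC.signedArcs_vec, mem_signedArcs]
  rcases hC.isSignVector_vec b.1 with h' | h' | h' <;> rcases unit_int_cases b.2 with h'' | h'' <;>
    simp [h', h''] at hlt ⊢

/-- Minty's painting lemma, where the edges are painted by a set of arcs `F`. -/
theorem DualPair.painting (h : DualPair M V W) (F : Set (Arc E)) {a : Arc E} (ha : a ∈ F)
    (ha' : a.opp ∉ F) :
    (∃ C, IsSignedIn V M C ∧ a ∈ C ∧ C ⊆ F) ∨
      ∃ D, IsSignedIn W M✶ D ∧ a ∈ D ∧ ∀ b ∈ D, b.opp ∉ F := by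
  induction hn : {b : Arc E | b ∈ F ∧ b.opp ∉ F}.ncard using Nat.strong_induction_on
    generalizing F with
  | _ n ih =>
  -- The induction is on the number of one-way edges, those with exactly one arc in `F`. A one-way
  -- arc `b` other than `a` is made two-way, or its edge is removed from `F`.
  by_cases hb : ∃ b ∈ F, b.opp ∉ F ∧ b ≠ a
  · obtain ⟨b, hbF, hbF', hba⟩ := hb
    have hab : a.opp ≠ b := by
      rintro rfl
      exact ha' hbF
    have hba' : b.opp ≠ a := by
      rintro rfl
      simp at hab
    have hlt : ∀ F' : Set (Arc E), (∀ c, c ≠ b → c ≠ b.opp → (c ∈ F' ↔ c ∈ F)) →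
        (b ∈ F' ↔ b.opp ∈ F') → {c : Arc E | c ∈ F' ∧ c.opp ∉ F'}.ncard < n := by
      intro F' h1 h2
      rw [← hn]
      apply Set.ncard_lt_ncard _ (Set.toFinite _)
      refine ⟨?_, fun hsub => ?_⟩
      · rintro c ⟨hc1, hc2⟩
        have hcb : c ≠ b := by
          rintro rfl
          exact hc2 (h2.1 hc1)
        have hcb' : c ≠ b.opp := by
          rintro rfl
          simp only [Arc.opp_opp] at hc2
          exact hc2 (h2.2 hc1)
        refine ⟨(h1 c hcb hcb').1 hc1, fun hc3 => hc2 ((h1 _ ?_ ?_).2 hc3)⟩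
        · rintro rfl
          simp at hcb'
        · intro h3
          apply hcb
          simpa using congrArg Arc.opp h3
      · obtain ⟨h3, h4⟩ := hsub ⟨hbF, hbF'⟩
        exact h4 (h2.1 h3)
    have key1 := ih _ (hlt (insert b.opp F) (by
      intro c h1 h2
      simp [h2]) (by simp [hbF])) (insert b.opp F) (by simp [ha]) (by
        simp only [mem_insert_iff, not_or]
        refine ⟨fun h1 => hba ?_, ha'⟩
        simpa using (congrArg Arc.opp h1).symm) rfl
    have key2 := ih _ (hlt (F \ {b}) (by
      intro c h1 h2
      simp [h1]) (by simp [hbF'])) (F \ {b}) (by simp [ha, hba.symm]) (by simp [ha']) rfl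
    rcases key1 with ⟨C, hC, haC, hCF⟩ | ⟨D, hD, haD, hDF⟩
    swap
    · right
      exact ⟨D, hD, haD, fun c hc hc' => hDF c hc (mem_insert_of_mem _ hc')⟩
    rcases key2 with ⟨C', hC', haC', hCF'⟩ | ⟨D, hD, haD, hDF⟩
    · left
      exact ⟨C', hC', haC', hCF'.trans sdiff_subset⟩
    by_cases h1 : b.opp ∈ C
    swap
    · left
      refine ⟨C, hC, haC, fun c hc => ?_⟩
      rcases hCF hc with rfl | h2
      · exact absurd hc h1
      · exact h2
    by_cases h2 : b.opp ∈ D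
    swap
    · right
      refine ⟨D, hD, haD, fun c hc hc' => hDF c hc ⟨hc', ?_⟩⟩
      rintro rfl
      simp at h2
      exact h2 hc
    -- Both `C` and `D` now use `b.opp`. Orthogonality gives an arc of `D` whose opposite is in `C`;
    -- by the constraints on `C` and `D` it lies on the edge of `b`, where `C` and `D` agree.
    exfalso
    obtain ⟨c, hcD, hcC⟩ := h.exists_opp_mem hC hD haC haD
    rcases hCF hcC with h3 | h3
    · have : c = b := by simpa using congrArg Arc.opp h3
      subst this
      exact hD.opp_notMem hcD h2
    · have := hDF c hcD
      simp only [mem_sdiff, h3, mem_singleton_iff, true_and, not_not] at this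
      subst this
      exact hC.opp_notMem hcC h1
  -- Only `a` is one-way, so signs matter on no other edge and the unsigned lemma applies with `P`
  -- the set of two-way edges.
  · push Not at hb
    have haP : a.1 ∉ {e | ∀ b : Arc E, b.1 = e → b ∈ F} := fun h1 => ha' (h1 a.opp rfl)
    have hcases : ∀ b ∈ F, b ≠ a → b.1 ∈ {e | ∀ b : Arc E, b.1 = e → b ∈ F} := by
      intro b hbF hba c hc
      rcases Arc.eq_or_eq_opp hc with rfl | rfl
      · exact hbF
      · by_contra h1
        exact hba (hb b hbF h1)
    rcases exists_isCircuit_or_isCocircuit h.ground_eq haP with ⟨X, hXP, hX, haX⟩ | ⟨X, hX, haX, hXP⟩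
    · left
      have : ∃ C, IsSignedIn V M C ∧ a ∈ C ∧ edges C = X := by
        obtain ⟨C, hC, rfl⟩ := h.exists_circuit X hX
        rcases IsSignedIn.mem_or_opp_mem haX with h1 | h1
        · exact ⟨C, hC, h1, rfl⟩
        · exact ⟨opp C, hC.opp, by simpa using h1, by simp⟩
      obtain ⟨C, hC, haC, rfl⟩ := this
      refine ⟨C, hC, haC, fun b hbC => ?_⟩
      rcases hXP (fst_mem_edges hbC) with h1 | h1
      · rcases Arc.eq_or_eq_opp h1 with rfl | rfl
        · exact ha
        · exact absurd hbC (hC.opp_notMem haC)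
      · exact h1 b rfl
    · right
      have : ∃ C, IsSignedIn W M✶ C ∧ a ∈ C ∧ edges C = X := by
        obtain ⟨C, hC, rfl⟩ := h.exists_cocircuit X hX
        rcases IsSignedIn.mem_or_opp_mem haX with h1 | h1
        · exact ⟨C, hC, h1, rfl⟩
        · exact ⟨opp C, hC.opp, by simpa using h1, by simp⟩
      obtain ⟨D, hD, haD, rfl⟩ := this
      refine ⟨D, hD, haD, fun b hbD hbF => ?_⟩
      by_cases h1 : b.opp = a
      · subst h1
        exact hD.opp_notMem hbD haD
      · exact Set.disjoint_left.1 hXP (fst_mem_edges hbD) (hcases b.opp hbF h1)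

/-- Paint with the arcs along which `x` is positive. In the cocircuit alternative `x` would have no
negative term against `D` but a positive one at `a`. -/
lemma DualPair.exists_conformal (h : DualPair M V W) {x : E → ℤ} (hx : x ∈ V) {a : Arc E}
    (ha : 0 < x a.1 * a.2) :
    ∃ C, IsSignedIn V M C ∧ a ∈ C ∧ ∀ b ∈ C, 0 < x b.1 * b.2 := by
  rcases h.painting {b | 0 < x b.1 * b.2} (a := a) ha (by simp; omega) with h1 | ⟨D, hD, haD, h1⟩
  · exact h1
  · obtain ⟨b, hb, hlt⟩ := h.exists_opp_mem_of_vec hx hD ha haD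
    have := h1 b hb
    simp at this
    omega

/-- The criterion by which vectors of `V` are shown to vanish: exclude every signed circuit
conformal to them. -/
lemma DualPair.eq_zero_of_forall (h : DualPair M V W) {x : E → ℤ} (hx : x ∈ V)
    (hC : ∀ C, IsSignedIn V M C → ¬ ∀ b ∈ C, 0 < x b.1 * b.2) : x = 0 := by
  by_contra hne
  obtain ⟨e, he⟩ := Function.ne_iff.1 hne
  have : ∃ a : Arc E, 0 < x a.1 * a.2 := by
    rcases lt_or_gt_of_ne he with h1 | h1
    · exact ⟨(e, -1), by simpa using h1⟩
    · exact ⟨(e, 1), by simpa using h1⟩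
  obtain ⟨a, ha⟩ := this
  obtain ⟨C, hC', -, h1⟩ := h.exists_conformal hx ha
  exact hC C hC' h1

/-- Peel off a conformal signed circuit: what remains is a sign vector of `V` that vanishes on that
circuit. -/
lemma DualPair.exists_decomposition (h : DualPair M V W) {u : E → ℤ} (hu : u ∈ V)
    (hs : IsSignVector u) :
    ∃ S : Set (Set (Arc E)), (∀ C ∈ S, IsSignedIn V M C) ∧ S.PairwiseDisjoint edges ∧
      ⋃₀ S = signedArcs u := by
  induction hn : (Function.support u).ncard using Nat.strong_induction_on generalizing u with
  | _ n ih =>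
  by_cases h0 : u = 0
  · refine ⟨∅, by simp, by simp, ?_⟩
    ext a
    rcases unit_int_cases a.2 with h1 | h1 <;> simp [h0, mem_signedArcs, h1]
  · have : ∃ C, IsSignedIn V M C ∧ C ⊆ signedArcs u := by
      by_contra! hcon
      apply h0
      apply h.eq_zero_of_forall hu
      intro C hC hb
      apply hcon C hC
      intro b hbC
      have := hb b hbC
      rw [mem_signedArcs]
      rcases hs b.1 with h1 | h1 | h1 <;> rcases unit_int_cases b.2 with h2 | h2 <;>
        simp [h1, h2] at this ⊢
    obtain ⟨C, hC, hCu⟩ := this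
    have hval : ∀ e, (e ∈ edges C ∧ vec C e = u e ∧ u e ≠ 0) ∨ (e ∉ edges C ∧ vec C e = 0) := by
      intro e
      by_cases he : e ∈ edges C
      · obtain ⟨a, ha, rfl⟩ := he
        left
        have h1 := hCu ha
        rw [mem_signedArcs] at h1
        refine ⟨fst_mem_edges ha, ?_, ?_⟩
        · rw [h1, vec_apply_of_mem ha (hC.opp_notMem ha)]
        · rcases unit_int_cases a.2 with h2 | h2 <;> omega
      · exact Or.inr ⟨he, vec_apply_of_notMem he⟩
    have hs' : IsSignVector (u - vec C) := by
      intro e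
      rcases hval e with ⟨-, h1, -⟩ | ⟨-, h1⟩
      · left; simp [h1]
      · simpa [h1] using hs e
    obtain ⟨S, hS1, hS2, hS3⟩ := ih _ (by
      rw [← hn]
      apply Set.ncard_lt_ncard _ (Set.toFinite _)
      refine ⟨fun e he => ?_, fun hsub => ?_⟩
      · rcases hval e with ⟨-, h1, h2⟩ | ⟨-, h1⟩
        · exact h2
        · simpa [h1] using he
      · obtain ⟨e, he⟩ := hC.isCircuit.nonempty
        rcases hval e with ⟨-, h1, h2⟩ | ⟨h1, -⟩
        · have := hsub h2
          simp [h1] at this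
        · exact h1 he) (V.sub_mem hu hC.vec_mem) hs' rfl
    have hedge : ∀ D ∈ S, Disjoint (edges C) (edges D) := by
      intro D hD
      rw [Set.disjoint_left]
      rintro e heC ⟨a, ha, rfl⟩
      have h1 : a ∈ ⋃₀ S := ⟨D, hD, ha⟩
      rw [hS3, mem_signedArcs] at h1
      rcases hval a.1 with ⟨-, h2, -⟩ | ⟨h2, -⟩
      · rw [Pi.sub_apply, h2, sub_self] at h1
        rcases unit_int_cases a.2 with h3 | h3 <;> omega
      · exact h2 heC
    refine ⟨insert C S, ?_, ?_, ?_⟩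
    · rintro D (rfl | hD)
      · exact hC
      · exact hS1 D hD
    · rw [Set.pairwiseDisjoint_insert]
      exact ⟨hS2, fun D hD _ => hedge D hD⟩
    · rw [sUnion_insert, hS3]
      ext a
      simp only [mem_union, mem_signedArcs, Pi.sub_apply]
      rcases hval a.1 with ⟨h1, h2, h3⟩ | ⟨h1, h2⟩
      · rw [h2]
        constructor
        · rintro (h4 | h4)
          · exact hCu h4
          · rcases unit_int_cases a.2 with h3 | h3 <;> omega
        · intro h4
          left
          rw [← hC.signedArcs_vec, mem_signedArcs, h2, h4]
      · rw [h2, sub_zero]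
        constructor
        · rintro (h4 | h4)
          · exact absurd (fst_mem_edges h4) h1
          · exact h4
        · exact Or.inr

end SignedCircuits

end RegularMatroid

namespace RegularMatroid

/-! ### Deletion and contraction: the upper bound by the number of bases -/

section Counting

variable {E : Type*} {V W : AddSubgroup (E → ℤ)} {M : Matroid E}

/-- Orientations of the edges outside `P` and `Q` whose signed circuits, after bi-orienting `P` and
deleting `Q`, satisfy `s`, and whose signed cocircuits, after bi-orienting `Q` and deleting `P`,
satisfy `t`. -/
def minorCompatible (V W : AddSubgroup (E → ℤ)) (M : Matroid E) (s t : Set (Arc E) → Prop)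
    (P Q : Set E) : Set (Set (Arc E)) :=
  {O | (∀ a ∈ O, a.1 ∉ P ∧ a.1 ∉ Q) ∧ (∀ a : Arc E, a.1 ∉ P → a.1 ∉ Q → (a ∈ O ↔ a.opp ∉ O)) ∧
    (∀ C, IsSignedIn V M C → C ⊆ O ∪ {a | a.1 ∈ P} → s C) ∧
    (∀ D, IsSignedIn W M✶ D → D ⊆ O ∪ {a | a.1 ∈ Q} → t D)}

lemma minorCompatible_dual (s t : Set (Arc E) → Prop) (P Q : Set E) :
    minorCompatible W V M✶ t s Q P = minorCompatible V W M s t P Q := by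
  ext O
  simp only [minorCompatible, Matroid.dual_dual, mem_ofPred_eq]
  constructor
  · rintro ⟨h1, h2, h3, h4⟩
    exact ⟨fun a ha => (h1 a ha).symm, fun a ha hb => h2 a hb ha, h4, h3⟩
  · rintro ⟨h1, h2, h3, h4⟩
    exact ⟨fun a ha => (h1 a ha).symm, fun a ha hb => h2 a hb ha, h4, h3⟩

/-- Contracting `e` only enlarges the set of signed circuits to be tested; each signed cocircuit to
be tested was tested before. So only the circuit condition is left as a hypothesis. -/
lemma mem_minorCompatible_insert {s t : Set (Arc E) → Prop} {P Q : Set E} {O : Set (Arc E)}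
    {e : E} {i : ℤˣ} (hO : ∀ a ∈ O, a.1 ≠ e)
    (h : insert (e, i) O ∈ minorCompatible V W M s t P Q)
    (hC : ∀ C, IsSignedIn V M C → C ⊆ O ∪ {a | a.1 ∈ insert e P} → s C) :
    O ∈ minorCompatible V W M s t (insert e P) Q := by
  obtain ⟨h1, h2, h3, h4⟩ := h
  refine ⟨fun a ha => ?_, fun a ha hb => ?_, hC, fun D hD hDO => h4 D hD fun a ha => ?_⟩
  · have := h1 a (mem_insert_of_mem _ ha)
    simpa [hO a ha] using this
  · simp only [mem_insert_iff, not_or] at ha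
    have h5 := h2 a ha.2 hb
    have h6 : a ≠ (e, i) := by
      rintro rfl
      exact ha.1 rfl
    have h7 : a.opp ≠ (e, i) := by
      intro h8
      exact ha.1 (congrArg Prod.fst h8)
    rwa [mem_insert_iff, mem_insert_iff, or_iff_right h6, or_iff_right h7] at h5
  · rcases hDO ha with h5 | h5
    · exact Or.inl (mem_insert_of_mem _ h5)
    · exact Or.inr h5

variable [Fintype E]

/-- A circuit inside the bioriented set `P` would have both signings satisfying `s`, so `P` is
independent; dually `Q` is coindependent. -/
lemma DualPair.isBase_of_minorCompatible (h : DualPair M V W) {s t : Set (Arc E) → Prop}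
    (hs : ∀ C, IsSignedIn V M C → s C → ¬ s (opp C))
    (ht : ∀ D, IsSignedIn W M✶ D → t D → ¬ t (opp D)) {P Q : Set E} (hPQ : Pᶜ = Q)
    {O : Set (Arc E)} (hO : O ∈ minorCompatible V W M s t P Q) : M.IsBase P := by
  have key : ∀ {V W : AddSubgroup (E → ℤ)} {M : Matroid E} {s t : Set (Arc E) → Prop}
      {P Q : Set E}, DualPair M V W → (∀ C, IsSignedIn V M C → s C → ¬ s (opp C)) →
      O ∈ minorCompatible V W M s t P Q → M.Indep P := by
    intro V W M s t P Q h hs hO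
    by_contra hP
    have hd : M.Dep P := ⟨hP, by simp [h.ground_eq]⟩
    obtain ⟨X, hXP, hX⟩ := hd.exists_isCircuit_subset
    obtain ⟨C, hC, rfl⟩ := h.exists_circuit X hX
    have hsub : ∀ C' : Set (Arc E), edges C' = edges C → C' ⊆ O ∪ {a | a.1 ∈ P} :=
      fun C' h1 a ha => Or.inr (hXP (h1 ▸ fst_mem_edges ha))
    exact hs C hC (hO.2.2.1 C hC (hsub C rfl)) (hO.2.2.1 _ hC.opp (hsub _ (edges_opp C)))
  have h1 := key h hs hO
  rw [← minorCompatible_dual] at hO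
  have h2 : M.Coindep Q := key h.symm ht hO
  apply h1.isBase_of_spanning
  rw [Matroid.spanning_iff_compl_coindep (by simp [h.ground_eq]), h.ground_eq,
    ← compl_eq_univ_sdiff, hPQ]
  exact h2

/-- Bases split according to whether they contain `e`. Correspondingly, with `T i` the orientations
of the other edges that extend by the arc `(e, i)`, the union and the intersection of `T 1` and `T
(-1)` lie in those of the contraction and deletion families, whence the inequality for the sums of
the cardinalities. -/
theorem DualPair.ncard_minorCompatible_le (h : DualPair M V W) {s t : Set (Arc E) → Prop}
    (hs : ∀ C, IsSignedIn V M C → s C → ¬ s (opp C))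
    (ht : ∀ D, IsSignedIn W M✶ D → t D → ¬ t (opp D)) {P Q : Set E} (hPQ : Disjoint P Q) :
    (minorCompatible V W M s t P Q).ncard ≤ {B | M.IsBase B ∧ P ⊆ B ∧ Disjoint B Q}.ncard := by
  induction hn : (P ∪ Q)ᶜ.ncard generalizing P Q with
  | zero =>
    rw [Set.ncard_eq_zero] at hn
    have hcov : ∀ e, e ∈ P ∨ e ∈ Q := by
      intro e
      by_contra he
      exact (hn ▸ he : e ∈ (∅ : Set E))
    have hc : Pᶜ = Q := by
      ext e
      constructor
      · exact fun he => (hcov e).resolve_left he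
      · exact fun he he' => Set.disjoint_left.1 hPQ he' he
    rcases (minorCompatible V W M s t P Q).eq_empty_or_nonempty with h0 | ⟨O, hO⟩
    · simp [h0]
    · have hB := h.isBase_of_minorCompatible hs ht hc hO
      have h1 : minorCompatible V W M s t P Q ⊆ {∅} := by
        intro O' hO'
        rw [mem_singleton_iff, eq_empty_iff_forall_notMem]
        intro a ha
        rcases hcov a.1 with h1 | h1
        · exact (hO'.1 a ha).1 h1
        · exact (hO'.1 a ha).2 h1
      calc _ ≤ ({∅} : Set (Set (Arc E))).ncard := Set.ncard_le_ncard h1 (Set.toFinite _)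
        _ = ({P} : Set (Set E)).ncard := by simp
        _ ≤ _ := by
          apply Set.ncard_le_ncard _ (Set.toFinite _)
          rw [singleton_subset_iff]
          exact ⟨hB, subset_rfl, hPQ⟩
  | succ n ih =>
    have hne : ((P ∪ Q)ᶜ).Nonempty := by
      rw [← Set.ncard_pos]
      omega
    obtain ⟨e, he⟩ := hne
    have heP : e ∉ P := fun h1 => he (Or.inl h1)
    have heQ : e ∉ Q := fun h1 => he (Or.inr h1)
    have hcard : ((insert e (P ∪ Q))ᶜ).ncard = n := by
      have h1 : (insert e (P ∪ Q))ᶜ = (P ∪ Q)ᶜ \ {e} := by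
        ext f
        simp only [mem_compl_iff, mem_insert_iff, mem_sdiff, mem_singleton_iff]
        tauto
      rw [h1, Set.ncard_sdiff_singleton_of_mem he, hn, Nat.add_sub_cancel]
    have ihP := ih (P := insert e P) (Q := Q)
      (Set.disjoint_insert_left.2 ⟨heQ, hPQ⟩) (by rw [insert_union, hcard])
    have ihQ := ih (P := P) (Q := insert e Q)
      (Set.disjoint_insert_right.2 ⟨heP, hPQ⟩) (by rw [union_insert, hcard])
    set T : ℤˣ → Set (Set (Arc E)) := fun i =>
      {O | (∀ a ∈ O, a.1 ≠ e) ∧ insert (e, i) O ∈ minorCompatible V W M s t P Q} with hT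
    set GP := minorCompatible V W M s t (insert e P) Q with hGP
    set GQ := minorCompatible V W M s t P (insert e Q) with hGQ
    have hcover : minorCompatible V W M s t P Q ⊆
        (insert ((e, 1) : Arc E)) '' T 1 ∪ (insert ((e, -1) : Arc E)) '' T (-1) := by
      intro O hO
      have hmem : ∀ i : ℤˣ, (e, i) ∈ O → O ∈ (insert ((e, i) : Arc E)) '' T i := by
        intro i hi
        have h1 : insert (e, i) (O \ {a | a.1 = e}) = O := by
          ext a
          simp only [mem_insert_iff, mem_sdiff, mem_ofPred_eq]
          constructor
          · rintro (rfl | h2)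
            · exact hi
            · exact h2.1
          · intro ha
            by_cases h2 : a.1 = e
            · left
              rcases Arc.eq_or_eq_opp (a := a) (b := (e, i)) h2 with h3 | h3
              · exact h3
              · exact absurd (h3 ▸ ha) ((hO.2.1 (e, i) heP heQ).1 hi)
            · exact Or.inr ⟨ha, h2⟩
        exact ⟨O \ {a | a.1 = e}, ⟨fun a ha => ha.2, h1.symm ▸ hO⟩, h1⟩
      by_cases h1 : ((e, 1) : Arc E) ∈ O
      · exact Or.inl (hmem 1 h1)
      · exact Or.inr (hmem (-1) ((hO.2.1 (e, -1) heP heQ).2 (by simpa [Arc.opp] using h1)))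
    have hdual : ∀ {i : ℤˣ} {O : Set (Arc E)}, O ∈ T i →
        (∀ D, IsSignedIn W M✶ D → D ⊆ O ∪ {a | a.1 ∈ insert e Q} → t D) → O ∈ GQ := by
      intro i O hO hD
      rw [hGQ, ← minorCompatible_dual]
      refine mem_minorCompatible_insert (i := i) hO.1 ?_ hD
      rw [minorCompatible_dual]
      exact hO.2
    -- If both minors fail, the offending circuit and cocircuit both use the arc opposite to `(e,
    -- i)`, since otherwise they were already tested. Orthogonality then yields an edge other than
    -- `e` with both arcs in `O`.
    have hunion : ∀ i, T i ⊆ GP ∪ GQ := by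
      intro i O hO
      by_contra hcon
      simp only [mem_union, not_or] at hcon
      have hC : ∃ C, IsSignedIn V M C ∧ C ⊆ O ∪ {a | a.1 ∈ insert e P} ∧ ¬ s C := by
        by_contra! h1
        exact hcon.1 (mem_minorCompatible_insert hO.1 hO.2 h1)
      have hD : ∃ D, IsSignedIn W M✶ D ∧ D ⊆ O ∪ {a | a.1 ∈ insert e Q} ∧ ¬ t D := by
        by_contra! h1
        exact hcon.2 (hdual hO h1)
      obtain ⟨C, hC, hCO, hCs⟩ := hC
      obtain ⟨D, hD, hDO, hDt⟩ := hD
      have hsplit : ∀ {X : Set (Arc E)} {R : Set E}, X ⊆ O ∪ {a | a.1 ∈ insert e R} →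
          Arc.opp (e, i) ∉ X → X ⊆ insert (e, i) O ∪ {a | a.1 ∈ R} := by
        intro X R hX hX' a ha
        rcases hX ha with h1 | h1 | h1
        · exact Or.inl (mem_insert_of_mem _ h1)
        · rcases Arc.eq_or_eq_opp (a := a) (b := (e, i)) h1 with h2 | h2
          · exact Or.inl (mem_insert_iff.2 (Or.inl h2))
          · exact absurd (h2 ▸ ha) hX'
        · exact Or.inr h1
      have hCe : Arc.opp (e, i) ∈ C := by
        by_contra h1
        exact hCs (hO.2.2.2.1 C hC (hsplit hCO h1))
      have hDe : Arc.opp (e, i) ∈ D := by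
        by_contra h1
        exact hDt (hO.2.2.2.2 D hD (hsplit hDO h1))
      obtain ⟨b, hbD, hbC⟩ := h.exists_opp_mem hC hD hCe hDe
      have hbe : b.1 ≠ e := by
        intro h1
        rcases Arc.eq_or_eq_opp (a := b) (b := (e, i)) h1 with h2 | h2
        · exact hD.opp_notMem hDe (by simpa [← h2] using hbD)
        · exact hC.opp_notMem hCe (by simpa [h2] using hbC)
      have hbO : b ∈ O := by
        rcases hDO hbD with h1 | h1 | h1
        · exact h1
        · exact absurd h1 hbe
        · rcases hCO hbC with h2 | h2 | h2
          · exact absurd h1 (hO.2.1 _ (mem_insert_of_mem _ h2)).2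
          · exact absurd h2 hbe
          · exact absurd h1 (Set.disjoint_left.1 hPQ h2)
      have hbP := hO.2.1 _ (mem_insert_of_mem _ hbO)
      have hbO' : b.opp ∈ O := by
        rcases hCO hbC with h1 | h1 | h1
        · exact h1
        · exact absurd h1 hbe
        · exact absurd h1 hbP.1
      exact (hO.2.2.1 b hbP.1 hbP.2).1 (mem_insert_of_mem _ hbO) (mem_insert_of_mem _ hbO')
    -- A signed circuit or cocircuit uses at most one arc of `e`, so it fits into one of the two
    -- extensions of `O` and is tested there.
    have hinter : T 1 ∩ T (-1) ⊆ GP ∩ GQ := by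
      rintro O ⟨hO1, hO2⟩
      have hsplit : ∀ {X : Set (Arc E)} {R : Set E}, X ⊆ O ∪ {a | a.1 ∈ insert e R} →
          (∀ a ∈ X, a.opp ∉ X) →
          X ⊆ insert (e, 1) O ∪ {a | a.1 ∈ R} ∨ X ⊆ insert (e, -1) O ∪ {a | a.1 ∈ R} := by
        intro X R hX hX'
        have aux : ∀ i : ℤˣ, Arc.opp (e, i) ∉ X → X ⊆ insert (e, i) O ∪ {a | a.1 ∈ R} := by
          intro i hi a ha
          rcases hX ha with h1 | h1 | h1
          · exact Or.inl (mem_insert_of_mem _ h1)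
          · rcases Arc.eq_or_eq_opp (a := a) (b := (e, i)) h1 with h2 | h2
            · exact Or.inl (mem_insert_iff.2 (Or.inl h2))
            · exact absurd (h2 ▸ ha) hi
          · exact Or.inr h1
        by_cases h1 : Arc.opp (e, 1) ∈ X
        · right
          apply aux
          have := hX' _ h1
          simp only [Arc.opp_opp] at this
          simpa [Arc.opp] using this
        · exact Or.inl (aux 1 h1)
      constructor
      · refine mem_minorCompatible_insert hO1.1 hO1.2 fun C hC hCO => ?_
        rcases hsplit hCO fun a => hC.opp_notMem with h1 | h1
        · exact hO1.2.2.2.1 C hC h1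
        · exact hO2.2.2.2.1 C hC h1
      · refine hdual hO1 fun D hD hDO => ?_
        rcases hsplit hDO fun a => hD.opp_notMem with h1 | h1
        · exact hO1.2.2.2.2 D hD h1
        · exact hO2.2.2.2.2 D hD h1
    have hbases : {B | M.IsBase B ∧ P ⊆ B ∧ Disjoint B Q} =
        {B | M.IsBase B ∧ insert e P ⊆ B ∧ Disjoint B Q} ∪
          {B | M.IsBase B ∧ P ⊆ B ∧ Disjoint B (insert e Q)} := by
      ext B
      simp only [mem_ofPred_eq, mem_union, insert_subset_iff, disjoint_insert_right]
      tauto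
    have hdisj : Disjoint {B | M.IsBase B ∧ insert e P ⊆ B ∧ Disjoint B Q}
        {B | M.IsBase B ∧ P ⊆ B ∧ Disjoint B (insert e Q)} := by
      rw [Set.disjoint_left]
      rintro B ⟨-, h1, -⟩ ⟨-, -, h2⟩
      exact Set.disjoint_left.1 h2 (h1 (mem_insert _ _)) (mem_insert _ _)
    rw [hbases, Set.ncard_union_eq hdisj (Set.toFinite _) (Set.toFinite _)]
    calc _ ≤ ((insert ((e, 1) : Arc E)) '' T 1 ∪ (insert ((e, -1) : Arc E)) '' T (-1)).ncard :=
          Set.ncard_le_ncard hcover (Set.toFinite _)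
      _ ≤ ((insert ((e, 1) : Arc E)) '' T 1).ncard + ((insert ((e, -1) : Arc E)) '' T (-1)).ncard :=
          Set.ncard_union_le _ _
      _ ≤ (T 1).ncard + (T (-1)).ncard :=
          add_le_add (Set.ncard_image_le (Set.toFinite _)) (Set.ncard_image_le (Set.toFinite _))
      _ = (T 1 ∪ T (-1)).ncard + (T 1 ∩ T (-1)).ncard :=
          (Set.ncard_union_add_ncard_inter _ _ (Set.toFinite _) (Set.toFinite _)).symm
      _ ≤ (GP ∪ GQ).ncard + (GP ∩ GQ).ncard :=
          add_le_add (Set.ncard_le_ncard (union_subset (hunion _) (hunion _)) (Set.toFinite _))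
            (Set.ncard_le_ncard hinter (Set.toFinite _))
      _ = GP.ncard + GQ.ncard :=
          Set.ncard_union_add_ncard_inter _ _ (Set.toFinite _) (Set.toFinite _)
      _ ≤ _ := add_le_add ihP ihQ

/-- There are at most as many orientations compatible with arbitrary signatures as bases. -/
theorem DualPair.ncard_compatible_le (h : DualPair M V W) {s t : Set (Arc E) → Prop}
    (hs : ∀ C, IsSignedIn V M C → s C → ¬ s (opp C))
    (ht : ∀ D, IsSignedIn W M✶ D → t D → ¬ t (opp D)) :
    {O | IsOrientation O ∧ (∀ C, IsSignedIn V M C → C ⊆ O → s C) ∧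
      (∀ D, IsSignedIn W M✶ D → D ⊆ O → t D)}.ncard ≤ {B | M.IsBase B}.ncard := by
  have h1 := h.ncard_minorCompatible_le hs ht (P := ∅) (Q := ∅) (by simp)
  simpa [minorCompatible, isOrientation_iff] using h1

end Counting

end RegularMatroid

namespace RegularMatroid

/-! ### Reversals as translations by vectors -/

section Reversals

variable {E : Type*} {V W : AddSubgroup (E → ℤ)} {M : Matroid E}

lemma signedArcs_add {u v : E → ℤ} (h : ∀ e, u e = 0 ∨ v e = 0) :
    signedArcs (u + v) = signedArcs u ∪ signedArcs v := by
  ext a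
  simp only [mem_signedArcs, mem_union, Pi.add_apply]
  rcases unit_int_cases a.2 with h1 | h1 <;> rcases h a.1 with h2 | h2 <;> rw [h1, h2] <;> omega

lemma IsSignVector.add {u v : E → ℤ} (hu : IsSignVector u) (hv : IsSignVector v)
    (h : ∀ e, u e = 0 ∨ v e = 0) : IsSignVector (u + v) := by
  intro e
  rcases h e with h1 | h1
  · simpa [h1] using hv e
  · simpa [h1] using hu e

lemma IsSignVector.apply_eq_of_subset {z : E → ℤ} (hz : IsSignVector z) {O : Set (Arc E)}
    (hO : IsOrientation O) (hzO : signedArcs z ⊆ O) (e : E) : z e = 0 ∨ z e = vec O e := by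
  rcases hz e with h | h | h
  · exact Or.inl h
  · right
    have := (hO.vec_eq_iff (e, 1)).2 (hzO (by simpa [mem_signedArcs] using h))
    rw [h]
    simpa using this.symm
  · right
    have := (hO.vec_eq_iff (e, -1)).2 (hzO (by simpa [mem_signedArcs] using h))
    rw [h]
    simpa using this.symm

lemma reverse_eq_signedArcs {z : E → ℤ} (hz : IsSignVector z) {O : Set (Arc E)}
    (hO : IsOrientation O) (hzO : signedArcs z ⊆ O) :
    (O \ signedArcs z) ∪ opp (signedArcs z) = signedArcs (vec O - (2 : ℤ) • z) := by
  ext a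
  have h1 := hz.apply_eq_of_subset hO hzO a.1
  have h2 := hO.vec_cases a.1
  have h3 := hO.vec_eq_iff a
  simp only [mem_union, mem_sdiff, mem_opp, mem_signedArcs, Pi.sub_apply, Pi.smul_apply,
    Arc.opp_fst, Arc.opp_snd, Units.val_neg, smul_eq_mul, ← h3]
  rcases unit_int_cases a.2 with h4 | h4 <;> rw [h4] <;> omega

lemma isOrientation_reverse {z : E → ℤ} (hz : IsSignVector z) {O : Set (Arc E)}
    (hO : IsOrientation O) (hzO : signedArcs z ⊆ O) :
    IsOrientation ((O \ signedArcs z) ∪ opp (signedArcs z)) := by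
  rw [reverse_eq_signedArcs hz hO hzO]
  apply isOrientation_signedArcs
  intro e
  have h1 := hz.apply_eq_of_subset hO hzO e
  have h2 := hO.vec_cases e
  simp only [Pi.sub_apply, Pi.smul_apply, smul_eq_mul]
  omega

lemma vec_reverse {z : E → ℤ} (hz : IsSignVector z) {O : Set (Arc E)}
    (hO : IsOrientation O) (hzO : signedArcs z ⊆ O) :
    vec ((O \ signedArcs z) ∪ opp (signedArcs z)) = vec O - (2 : ℤ) • z := by
  rw [reverse_eq_signedArcs hz hO hzO]
  apply vec_signedArcs
  intro e
  right
  have h1 := hz.apply_eq_of_subset hO hzO e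
  have h2 := hO.vec_cases e
  simp only [Pi.sub_apply, Pi.smul_apply, smul_eq_mul]
  omega

/-- Replaces a disjoint family by the sum of its vectors; `DualPair.exists_decomposition` goes back.
-/
lemma exists_vector_of_family {S : Set (Set (Arc E))} (hfin : S.Finite)
    (hS : ∀ C ∈ S, IsSignedIn V M C) (hd : S.PairwiseDisjoint edges) :
    ∃ u ∈ V, IsSignVector u ∧ signedArcs u = ⋃₀ S := by
  induction S, hfin using Set.Finite.induction_on with
  | empty =>
    refine ⟨0, V.zero_mem, fun e => Or.inl rfl, ?_⟩
    ext a
    rcases unit_int_cases a.2 with h | h <;> simp [mem_signedArcs, h]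
  | @insert C S hCS hfin ih =>
    obtain ⟨u, hu, hus, hua⟩ := ih (fun D hD => hS D (mem_insert_of_mem _ hD))
      (hd.subset (subset_insert _ _))
    have hC := hS C (mem_insert _ _)
    have hzero : ∀ e, vec C e = 0 ∨ u e = 0 := by
      intro e
      by_cases he : e ∈ edges C
      · right
        by_contra hne
        have h1 : e ∈ edges (⋃₀ S) := by
          rw [← hua, edges_signedArcs hus]
          exact hne
        obtain ⟨a, ⟨D, hD, ha⟩, rfl⟩ := h1
        have hne' : C ≠ D := by
          rintro rfl
          exact hCS hD
        exact Set.disjoint_left.1 (hd (mem_insert _ _) (mem_insert_of_mem _ hD) hne') he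
          (fst_mem_edges ha)
      · exact Or.inl (vec_apply_of_notMem he)
    refine ⟨vec C + u, V.add_mem hC.vec_mem hu, hC.isSignVector_vec.add hus hzero, ?_⟩
    rw [signedArcs_add hzero, hC.signedArcs_vec, hua, sUnion_insert]

/-- The orientation `O'` arises from `O` by reversing the arcs of the disjoint sign vectors `u`
and `v`. -/
structure IsVectorReversal (V W : AddSubgroup (E → ℤ)) (O O' : Set (Arc E)) (u v : E → ℤ) :
    Prop where
  left_mem : u ∈ V
  right_mem : v ∈ W
  left_sign : IsSignVector u
  right_sign : IsSignVector v
  eq_zero_or : ∀ e, u e = 0 ∨ v e = 0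
  left_subset : signedArcs u ⊆ O
  right_subset : signedArcs v ⊆ O
  eq : O' = (O \ (signedArcs u ∪ signedArcs v)) ∪ opp (signedArcs u ∪ signedArcs v)

/-- Two orientations that differ by twice an element of the sum of the groups `V` and `W`. -/
def ReversalEquiv (V W : AddSubgroup (E → ℤ)) (O O' : Set (Arc E)) : Prop :=
  ∃ u ∈ V, ∃ v ∈ W, vec O = vec O' + (2 : ℤ) • (u + v)

lemma ReversalEquiv.refl (O : Set (Arc E)) : ReversalEquiv V W O O :=
  ⟨0, V.zero_mem, 0, W.zero_mem, by simp⟩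

lemma ReversalEquiv.symm {O O' : Set (Arc E)} (h : ReversalEquiv V W O O') :
    ReversalEquiv V W O' O := by
  obtain ⟨u, hu, v, hv, h⟩ := h
  refine ⟨-u, V.neg_mem hu, -v, W.neg_mem hv, ?_⟩
  rw [h]
  module

lemma ReversalEquiv.trans {O O' O'' : Set (Arc E)} (h : ReversalEquiv V W O O')
    (h' : ReversalEquiv V W O' O'') : ReversalEquiv V W O O'' := by
  obtain ⟨u, hu, v, hv, h⟩ := h
  obtain ⟨u', hu', v', hv', h'⟩ := h'
  refine ⟨u + u', V.add_mem hu hu', v + v', W.add_mem hv hv', ?_⟩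
  rw [h, h']
  module

lemma IsVectorReversal.swap {O O' : Set (Arc E)} {u v : E → ℤ}
    (h : IsVectorReversal V W O O' u v) : IsVectorReversal W V O O' v u where
  left_mem := h.right_mem
  right_mem := h.left_mem
  left_sign := h.right_sign
  right_sign := h.left_sign
  eq_zero_or := fun e => (h.eq_zero_or e).symm
  left_subset := h.right_subset
  right_subset := h.left_subset
  eq := by rw [union_comm (signedArcs v), ← h.eq]

variable {O O' : Set (Arc E)} {u v : E → ℤ}

lemma IsVectorReversal.vec_eq (h : IsVectorReversal V W O O' u v) (hO : IsOrientation O) :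
    vec O' = vec O - (2 : ℤ) • (u + v) := by
  have h1 := signedArcs_add h.eq_zero_or
  rw [h.eq, ← h1]
  apply vec_reverse (h.left_sign.add h.right_sign h.eq_zero_or) hO
  rw [h1]
  exact union_subset h.left_subset h.right_subset

lemma IsVectorReversal.isOrientation (h : IsVectorReversal V W O O' u v) (hO : IsOrientation O) :
    IsOrientation O' := by
  have h1 := signedArcs_add h.eq_zero_or
  rw [h.eq, ← h1]
  apply isOrientation_reverse (h.left_sign.add h.right_sign h.eq_zero_or) hO
  rw [h1]
  exact union_subset h.left_subset h.right_subset

lemma IsVectorReversal.reversalEquiv (h : IsVectorReversal V W O O' u v) (hO : IsOrientation O) :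
    ReversalEquiv V W O O' :=
  ⟨u, h.left_mem, v, h.right_mem, by rw [h.vec_eq hO]; simp⟩

/-- The reversed arcs belong to the new orientation. -/
lemma IsVectorReversal.opp_mem (h : IsVectorReversal V W O O' u v) {a : Arc E}
    (ha : a ∈ signedArcs u) : a.opp ∈ O' := by
  rw [h.eq]
  right
  simpa using Or.inl ha

lemma IsVectorReversal.mem_iff (h : IsVectorReversal V W O O' u v) {a : Arc E}
    (hu : u a.1 = 0) (hv : v a.1 = 0) : a ∈ O' ↔ a ∈ O := by
  rw [h.eq]
  simp only [mem_union, mem_sdiff, mem_opp, mem_signedArcs, Arc.opp_fst, Arc.opp_snd, hu, hv,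
    Units.val_neg]
  rcases unit_int_cases a.2 with h1 | h1 <;> simp [h1]

variable [Fintype E]

/-- Orthogonality makes arbitrary `u` and `v` disjointly supported sign vectors, so equivalence of
orientations is already realised by a single disjoint reversal. -/
lemma DualPair.isVectorReversal (h : DualPair M V W) (hO : IsOrientation O)
    (hO' : IsOrientation O') (hu : u ∈ V) (hv : v ∈ W)
    (heq : vec O = vec O' + (2 : ℤ) • (u + v)) : IsVectorReversal V W O O' u v := by
  have hsum : ∀ e, vec O e = vec O' e + 2 * (u e + v e) := by
    intro e
    have := congrFun heq e
    simpa only [Pi.add_apply, Pi.smul_apply, smul_eq_mul] using this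
  -- Entries of orientations are 1 or -1, so `u e + v e` is 0, 1 or -1; two integers with such a sum
  -- are never both positive or both negative. As the products sum to zero, each of them vanishes.
  have hmul : ∀ e, u e * v e ≤ 0 := by
    intro e
    have h1 := hO.vec_cases e
    have h2 := hO'.vec_cases e
    have h3 := hsum e
    have h4 : u e + v e = 0 ∨ u e + v e = 1 ∨ u e + v e = -1 := by omega
    have h5 : u e ≤ -1 ∨ u e = 0 ∨ 1 ≤ u e := by omega
    rcases h4 with h4 | h4 | h4
    · have h6 : v e = - u e := by omega
      rw [h6]
      nlinarith [mul_self_nonneg (u e)]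
    · have h6 : v e = 1 - u e := by omega
      rw [h6]
      rcases h5 with h5 | h5 | h5 <;> nlinarith
    · have h6 : v e = -1 - u e := by omega
      rw [h6]
      rcases h5 with h5 | h5 | h5 <;> nlinarith
  have hzero : ∀ e, u e = 0 ∨ v e = 0 := by
    intro e
    have h0 := h.orthogonal u hu v hv
    have := (Finset.sum_eq_zero_iff_of_nonpos fun e _ => hmul e).1 h0 e (Finset.mem_univ _)
    exact mul_eq_zero.1 this
  have hval : ∀ e, (u e = 0 ∧ v e = 0 ∧ vec O' e = vec O e) ∨
      (u e = vec O e ∧ v e = 0 ∧ vec O' e = -vec O e) ∨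
      (u e = 0 ∧ v e = vec O e ∧ vec O' e = -vec O e) := by
    intro e
    have h1 := hO.vec_cases e
    have h2 := hO'.vec_cases e
    have h3 := hsum e
    have h4 := hzero e
    omega
  have hsu : IsSignVector u := by
    intro e
    have h1 := hO.vec_cases e
    have h2 := hval e
    omega
  have hsv : IsSignVector v := by
    intro e
    have h1 := hO.vec_cases e
    have h2 := hval e
    omega
  have hsub1 : signedArcs u ⊆ O := by
    intro a ha
    rw [mem_signedArcs] at ha
    rw [← hO.vec_eq_iff]
    have h2 := hval a.1
    rcases unit_int_cases a.2 with h3 | h3 <;> omega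
  have hsub2 : signedArcs v ⊆ O := by
    intro a ha
    rw [mem_signedArcs] at ha
    rw [← hO.vec_eq_iff]
    have h2 := hval a.1
    rcases unit_int_cases a.2 with h3 | h3 <;> omega
  refine ⟨hu, hv, hsu, hsv, hzero, hsub1, hsub2, ?_⟩
  have h1 := signedArcs_add hzero
  rw [← h1, reverse_eq_signedArcs (hsu.add hsv hzero) hO
    (by rw [h1]; exact union_subset hsub1 hsub2), ← hO'.signedArcs_vec]
  congr 1
  rw [heq]
  simp

end Reversals

/-! ### Triangulating signatures and the bijectivity of BBY -/

section Signatures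

variable {E : Type*} {V W : AddSubgroup (E → ℤ)} {M : Matroid E} {σ τ : Set (Set (Arc E))}

/-- Triangulating circuit signatures with respect to a group of integer vectors. -/
structure IsTriangulatingIn (V : AddSubgroup (E → ℤ)) (M : Matroid E) (σ : Set (Set (Arc E))) :
    Prop where
  signed : ∀ C ∈ σ, IsSignedIn V M C
  existsUnique : ∀ X : Set E, M.IsCircuit X → ∃! C : Set (Arc E), C ∈ σ ∧ edges C = X
  mem_of_subset : ∀ B, M.IsBase B → ∀ C, IsSignedIn V M C → C ⊆ extBasis M σ B → C ∈ σ

/-- The orientations all of whose signed circuits belong to `σ`. -/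
def compatibleIn (V : AddSubgroup (E → ℤ)) (M : Matroid E) (σ : Set (Set (Arc E))) :
    Set (Set (Arc E)) :=
  {O | IsOrientation O ∧ ∀ C, IsSignedIn V M C → C ⊆ O → C ∈ σ}

lemma IsTriangulatingIn.opp_notMem (hσ : IsTriangulatingIn V M σ) {C : Set (Arc E)}
    (hC : C ∈ σ) : opp C ∉ σ := by
  intro h
  have h1 := hσ.signed C hC
  exact h1.ne_opp ((hσ.existsUnique _ h1.isCircuit).unique ⟨h, by simp⟩ ⟨hC, rfl⟩)

lemma IsTriangulatingIn.mem_extBasis_iff (hσ : IsTriangulatingIn V M σ) (hM : M.E = univ)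
    {B : Set E} (hB : M.IsBase B) {a : Arc E} (ha : a.1 ∉ B) :
    a ∈ extBasis M σ B ↔ a.opp ∉ extBasis M σ B := by
  have hX := hB.fundCircuit_isCircuit (x := a.1) (by simp [hM]) ha
  obtain ⟨C, ⟨hC, hCX⟩, hu⟩ := hσ.existsUnique _ hX
  have haC : a.1 ∈ edges C := by
    rw [hCX]
    exact M.mem_fundCircuit _ _
  have key : ∀ b : Arc E, b.1 = a.1 → (b ∈ extBasis M σ B ↔ b ∈ C) := by
    intro b hb
    constructor
    · rintro (h1 | ⟨-, D, hD, hDX, hbD⟩)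
      · exact absurd (hb ▸ h1) ha
      · rw [hb] at hDX
        exact hu D ⟨hD, hDX⟩ ▸ hbD
    · intro h1
      exact Or.inr ⟨hb ▸ ha, C, hC, hb ▸ hCX, h1⟩
  rw [key a rfl, key a.opp rfl]
  constructor
  · exact fun h => (hσ.signed C hC).opp_notMem h
  · exact fun h => (IsSignedIn.mem_or_opp_mem haC).resolve_right h

lemma mem_extBasis_of_mem {B : Set E} {a : Arc E} (ha : a.1 ∈ B) : a ∈ extBasis M σ B :=
  Or.inl ha

lemma compatibleIn_opp_notMem (hσ : IsTriangulatingIn V M σ) {O O' : Set (Arc E)}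
    (hO : O ∈ compatibleIn V M σ) (hO' : O' ∈ compatibleIn V M σ) {C : Set (Arc E)}
    (hC : IsSignedIn V M C) (hCO : C ⊆ O) : ¬ opp C ⊆ O' := fun h =>
  hσ.opp_notMem (hO.2 C hC hCO) (hO'.2 _ hC.opp h)

lemma isBase_dual_compl (hM : M.E = univ) {B : Set E} (hB : M.IsBase B) : M✶.IsBase Bᶜ := by
  rw [compl_eq_univ_sdiff, ← hM]
  exact hB.compl_isBase_dual

/-- The form in which triangulation is used: a signature never contains both signings of a circuit.
-/
lemma IsTriangulatingIn.not_subset (hσ : IsTriangulatingIn V M σ) {B₁ B₂ : Set E}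
    (hB₁ : M.IsBase B₁) (hB₂ : M.IsBase B₂) {C : Set (Arc E)} (hC : IsSignedIn V M C)
    (h₁ : C ⊆ extBasis M σ B₁) (h₂ : opp C ⊆ extBasis M σ B₂) : False :=
  hσ.opp_notMem (hσ.mem_of_subset B₁ hB₁ C hC h₁) (hσ.mem_of_subset B₂ hB₂ _ hC.opp h₂)

variable [Fintype E]

/-- A signed circuit conformal to `u` would lie in `O` and its reverse in `O'`, so `σ` would contain
both. -/
lemma DualPair.left_eq_zero (h : DualPair M V W) (hσ : IsTriangulatingIn V M σ)
    {O O' : Set (Arc E)} {u v : E → ℤ} (hr : IsVectorReversal V W O O' u v)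
    (hO : O ∈ compatibleIn V M σ) (hO' : O' ∈ compatibleIn V M σ) : u = 0 := by
  apply h.eq_zero_of_forall hr.left_mem
  intro C hC hpos
  have hsub : C ⊆ signedArcs u := by
    intro b hb
    have := hpos b hb
    rw [mem_signedArcs]
    rcases hr.left_sign b.1 with h1 | h1 | h1 <;> rcases unit_int_cases b.2 with h2 | h2 <;>
      simp [h1, h2] at this ⊢
  refine compatibleIn_opp_notMem hσ hO hO' hC (hsub.trans hr.left_subset) ?_
  intro a ha
  simpa using hr.opp_mem (hsub (mem_opp.1 ha))

/-- Equivalent compatible orientations are equal. -/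
theorem DualPair.eq_of_reversalEquiv (h : DualPair M V W) (hσ : IsTriangulatingIn V M σ)
    (hτ : IsTriangulatingIn W M✶ τ) {O O' : Set (Arc E)}
    (hO : O ∈ compatibleIn V M σ ∩ compatibleIn W M✶ τ)
    (hO' : O' ∈ compatibleIn V M σ ∩ compatibleIn W M✶ τ) (hr : ReversalEquiv V W O O') :
    O = O' := by
  obtain ⟨u, hu, v, hv, heq⟩ := hr
  have hr := h.isVectorReversal hO.1.1 hO'.1.1 hu hv heq
  have h1 := h.left_eq_zero hσ hr hO.1 hO'.1
  have h2 := h.symm.left_eq_zero hτ hr.swap hO.2 hO'.2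
  rw [← hO.1.1.signedArcs_vec, ← hO'.1.1.signedArcs_vec, heq, h1, h2]
  simp

/-- The intersection of the externally and the internally oriented basis. -/
def orientBasis (M : Matroid E) (σ τ : Set (Set (Arc E))) (B : Set E) : Set (Arc E) :=
  extBasis M σ B ∩ extBasis M✶ τ Bᶜ

lemma DualPair.isOrientation_orientBasis (h : DualPair M V W) (hσ : IsTriangulatingIn V M σ)
    (hτ : IsTriangulatingIn W M✶ τ) {B : Set E} (hB : M.IsBase B) :
    IsOrientation (orientBasis M σ τ B) := by
  rw [isOrientation_iff]
  intro a
  by_cases ha : a.1 ∈ B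
  · have h1 := hτ.mem_extBasis_iff h.symm.ground_eq (isBase_dual_compl h.ground_eq hB)
      (a := a) (by simpa using ha)
    have h2 : a ∈ extBasis M σ B := mem_extBasis_of_mem ha
    have h3 : a.opp ∈ extBasis M σ B := mem_extBasis_of_mem ha
    simp only [orientBasis, mem_inter_iff, h2, h3, true_and]
    exact h1
  · have h1 := hσ.mem_extBasis_iff h.ground_eq hB ha
    have h2 : a ∈ extBasis M✶ τ Bᶜ := mem_extBasis_of_mem ha
    have h3 : a.opp ∈ extBasis M✶ τ Bᶜ := mem_extBasis_of_mem ha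
    simp only [orientBasis, mem_inter_iff, h2, h3, and_true]
    exact h1

lemma DualPair.orientBasis_mem (h : DualPair M V W) (hσ : IsTriangulatingIn V M σ)
    (hτ : IsTriangulatingIn W M✶ τ) {B : Set E} (hB : M.IsBase B) :
    orientBasis M σ τ B ∈ compatibleIn V M σ ∩ compatibleIn W M✶ τ := by
  have h1 := h.isOrientation_orientBasis hσ hτ hB
  exact ⟨⟨h1, fun C hC hCO => hσ.mem_of_subset B hB C hC (hCO.trans inter_subset_left)⟩,
    ⟨h1, fun C hC hCO => hτ.mem_of_subset _ (isBase_dual_compl h.ground_eq hB) C hC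
      (hCO.trans inter_subset_right)⟩⟩

/-- Bases whose orientations agree on the symmetric difference of the bases are equal. -/
theorem DualPair.eq_of_agree (h : DualPair M V W) (hσ : IsTriangulatingIn V M σ)
    (hτ : IsTriangulatingIn W M✶ τ) {B₁ B₂ : Set E} (hB₁ : M.IsBase B₁) (hB₂ : M.IsBase B₂)
    (hagree : ∀ a : Arc E, ¬ (a.1 ∈ B₁ ↔ a.1 ∈ B₂) →
      (a ∈ orientBasis M σ τ B₁ ↔ a ∈ orientBasis M σ τ B₂)) : B₁ = B₂ := by
  by_contra hne
  obtain ⟨e, he₁, he₂⟩ : ∃ e ∈ B₁, e ∉ B₂ := by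
    by_contra! hsub
    exact hne (hB₁.eq_of_subset_isBase hB₂ hsub)
  have hor₁ := h.isOrientation_orientBasis hσ hτ hB₁
  -- Common edges are two-way, edges outside both bases are absent, and on the symmetric difference
  -- the common orientation is kept on `B₂ \ B₁` and reversed on `B₁ \ B₂`. Thus a signed circuit in
  -- `F` fits the first external basis and its reverse the second; a signed cocircuit avoiding `F`
  -- in reverse fits the internal basis of `B₂` and its reverse that of `B₁`.
  set F : Set (Arc E) := {a | (a.1 ∈ B₁ ∧ a.1 ∈ B₂) ∨
    (a.1 ∈ B₁ ∧ a.1 ∉ B₂ ∧ a.opp ∈ orientBasis M σ τ B₁) ∨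
    (a.1 ∉ B₁ ∧ a.1 ∈ B₂ ∧ a ∈ orientBasis M σ τ B₁)} with hF
  obtain ⟨s, hs, -⟩ := hor₁ e
  have haF : Arc.opp (e, s) ∈ F := Or.inr (Or.inl ⟨he₁, he₂, by simpa using hs⟩)
  have haF' : Arc.opp (Arc.opp (e, s)) ∉ F := by
    rw [Arc.opp_opp]
    rintro (⟨-, h2⟩ | ⟨-, -, h2⟩ | ⟨h2, -⟩)
    · exact he₂ h2
    · exact hor₁.opp_notMem hs h2
    · exact h2 he₁
  rcases h.painting F haF haF' with ⟨C, hC, -, hCF⟩ | ⟨D, hD, -, hDF⟩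
  · refine hσ.not_subset hB₁ hB₂ hC (fun a ha => ?_) (opp_subset_iff.2 fun a ha => ?_)
    · rcases hCF ha with ⟨h1, h2⟩ | ⟨h1, h2, h3⟩ | ⟨h1, h2, h3⟩
      · exact mem_extBasis_of_mem h1
      · exact mem_extBasis_of_mem h1
      · exact h3.1
    · rw [mem_opp]
      rcases hCF ha with ⟨h1, h2⟩ | ⟨h1, h2, h3⟩ | ⟨h1, h2, h3⟩
      · exact mem_extBasis_of_mem h2
      · exact ((hagree a.opp (by simp [h1, h2])).1 h3).1
      · exact mem_extBasis_of_mem h2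
  · have hcases : ∀ b ∈ D, b ∈ extBasis M✶ τ B₂ᶜ ∧ b.opp ∈ extBasis M✶ τ B₁ᶜ := by
      intro b hb
      have h1 := hDF b hb
      by_cases hb₁ : b.1 ∈ B₁ <;> by_cases hb₂ : b.1 ∈ B₂
      · exact absurd (Or.inl ⟨hb₁, hb₂⟩) h1
      · refine ⟨mem_extBasis_of_mem hb₂, (hor₁.opp_mem fun h2 => h1 ?_).2⟩
        exact Or.inr (Or.inl ⟨hb₁, hb₂, by simpa using h2⟩)
      · refine ⟨((hagree b (by simp [hb₁, hb₂])).1 ?_).2, mem_extBasis_of_mem hb₁⟩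
        by_contra h2
        exact h1 (Or.inr (Or.inr ⟨hb₁, hb₂, hor₁.opp_mem h2⟩))
      · exact ⟨mem_extBasis_of_mem hb₂, mem_extBasis_of_mem hb₁⟩
    exact hτ.not_subset (isBase_dual_compl h.ground_eq hB₂) (isBase_dual_compl h.ground_eq hB₁) hD
      (fun b hb => (hcases b hb).1)
      (opp_subset_iff.2 fun b hb => mem_opp.2 (hcases b hb).2)

theorem DualPair.ncard_inter_le (h : DualPair M V W) (hσ : IsTriangulatingIn V M σ)
    (hτ : IsTriangulatingIn W M✶ τ) :
    (compatibleIn V M σ ∩ compatibleIn W M✶ τ).ncard ≤ {B | M.IsBase B}.ncard := by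
  refine le_trans (Set.ncard_le_ncard ?_ (Set.toFinite _)) (h.ncard_compatible_le
    (s := fun C => C ∈ σ) (t := fun D => D ∈ τ) (fun C _ hC => hσ.opp_notMem hC)
    (fun D _ hD => hτ.opp_notMem hD))
  exact fun O hO => ⟨hO.1.1, hO.1.2, hO.2.2⟩

/-- An injection into a set with at most as many elements as its source is onto. -/
theorem DualPair.bijOn_orientBasis (h : DualPair M V W) (hσ : IsTriangulatingIn V M σ)
    (hτ : IsTriangulatingIn W M✶ τ) :
    BijOn (orientBasis M σ τ) {B | M.IsBase B} (compatibleIn V M σ ∩ compatibleIn W M✶ τ) := by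
  have hmaps : MapsTo (orientBasis M σ τ) {B | M.IsBase B}
      (compatibleIn V M σ ∩ compatibleIn W M✶ τ) := fun B hB => h.orientBasis_mem hσ hτ hB
  have hinj : InjOn (orientBasis M σ τ) {B | M.IsBase B} := fun B₁ hB₁ B₂ hB₂ heq =>
    h.eq_of_agree hσ hτ hB₁ hB₂ fun a _ => by rw [heq]
  refine ⟨hmaps, hinj, ?_⟩
  have himg : orientBasis M σ τ '' {B | M.IsBase B} =
      compatibleIn V M σ ∩ compatibleIn W M✶ τ := by
    apply Set.eq_of_subset_of_ncard_le hmaps.image_subset _ (Set.toFinite _)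
    rw [hinj.ncard_image]
    exact h.ncard_inter_le hσ hτ
  exact himg.symm.subset

end Signatures

/-! ### Every reversal class contains a compatible orientation -/

section Existence

variable {E : Type*} [Fintype E] {V W : AddSubgroup (E → ℤ)} {M : Matroid E}
  {σ τ : Set (Set (Arc E))}

/-- Integer vectors embed into a linearly ordered group. -/
lemma exists_lex_embedding (E : Type*) [Fintype E] :
    ∃ f : (E → ℤ) →+ Lex (Fin (Fintype.card E) → ℤ), Function.Injective f := by
  refine ⟨⟨⟨fun x => toLex fun i => x ((Fintype.equivFin E).symm i), rfl⟩, fun x y => rfl⟩, ?_⟩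
  intro x y hxy
  ext e
  have := congrFun (toLex.injective hxy) (Fintype.equivFin E e)
  simpa using this

/-- Every reversal class contains an orientation compatible with the signatures given by a positive
cone, and these orientations are at most as many as the bases. -/
theorem DualPair.exists_representatives (h : DualPair M V W) :
    ∃ r : Set (Arc E) → Set (Arc E),
      (∀ O, IsOrientation O → ReversalEquiv V W O (r O)) ∧
      (r '' {O | IsOrientation O}).ncard ≤ {B | M.IsBase B}.ncard := by
  obtain ⟨f, hf⟩ := exists_lex_embedding E
  have hmax : ∀ K : Set (Set (Arc E)), ∃ O, K.Nonempty → O ∈ K ∧ ∀ O' ∈ K, f (vec O') ≤ f (vec O) := by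
    intro K
    by_cases hK : K.Nonempty
    · obtain ⟨O, hO, hle⟩ := Set.exists_max_image K (fun O => f (vec O)) (Set.toFinite _) hK
      exact ⟨O, fun _ => ⟨hO, hle⟩⟩
    · exact ⟨∅, fun h => absurd h hK⟩
  choose m hm using hmax
  set cls : Set (Arc E) → Set (Set (Arc E)) := fun O =>
    {O' | IsOrientation O' ∧ ReversalEquiv V W O O'} with hcls
  have hm' : ∀ O, IsOrientation O → m (cls O) ∈ cls O ∧
      ∀ O' ∈ cls O, f (vec O') ≤ f (vec (m (cls O))) := fun O hO =>
    hm _ ⟨O, hO, ReversalEquiv.refl O⟩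
  refine ⟨fun O => m (cls O), fun O hO => (hm' O hO).1.2, ?_⟩
  · refine le_trans (Set.ncard_le_ncard ?_ (Set.toFinite _)) (h.ncard_compatible_le
      (s := fun C => 0 < f (vec C)) (t := fun D => 0 < f (vec D)) ?_ ?_)
    · rintro _ ⟨O, hO, rfl⟩
      obtain ⟨⟨hor, heq⟩, hle⟩ := hm' O hO
      have key : ∀ {U : AddSubgroup (E → ℤ)} {N : Matroid E} {C : Set (Arc E)},
          IsSignedIn U N C → C ⊆ m (cls O) →
          (∀ O', vec (m (cls O)) = vec O' + (2 : ℤ) • vec C →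
            ReversalEquiv V W (m (cls O)) O') → 0 < f (vec C) := by
        intro U N C hC hCO hrev
        have hz := hC.isSignVector_vec
        have hsub : signedArcs (vec C) ⊆ m (cls O) := by rwa [hC.signedArcs_vec]
        have hv := vec_reverse hz hor hsub
        -- Reversing `C` stays in the class and changes the value of `f` by `-2 f (vec C)`, so
        -- maximality makes `f (vec C)` nonnegative; injectivity of `f` makes it nonzero.
        have h1 := hle _ ⟨isOrientation_reverse hz hor hsub,
          heq.trans (hrev _ (by rw [hv]; simp))⟩
        rw [hv, map_sub, map_zsmul] at h1
        have hne : f (vec C) ≠ 0 := by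
          rw [map_ne_zero_iff f hf]
          intro h2
          obtain ⟨a, ha⟩ := hC.nonempty
          have := vec_apply_of_mem ha (hC.opp_notMem ha)
          rw [h2] at this
          rcases unit_int_cases a.2 with h3 | h3 <;> simp [h3] at this
        have h2 : 0 ≤ (2 : ℤ) • f (vec C) := by
          simpa using h1
        by_contra hcon
        have h3 : f (vec C) < 0 := lt_of_le_of_ne (not_lt.1 hcon) hne
        rw [two_zsmul] at h2
        exact absurd h2 (not_le.2 (add_neg h3 h3))
      refine ⟨hor, fun C hC hCO => key hC hCO fun O' h1 => ?_, fun D hD hDO => key hD hDO fun O' h1 => ?_⟩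
      · exact ⟨vec C, hC.vec_mem, 0, W.zero_mem, by simpa using h1⟩
      · exact ⟨0, V.zero_mem, vec D, hD.vec_mem, by simpa using h1⟩
    · intro C _ h1 h2
      rw [vec_opp, map_neg] at h2
      exact absurd (neg_pos.1 h2) (not_lt.2 h1.le)
    · intro C _ h1 h2
      rw [vec_opp, map_neg] at h2
      exact absurd (neg_pos.1 h2) (not_lt.2 h1.le)

/-- Every orientation is equivalent to a compatible one. -/
theorem DualPair.exists_reversalEquiv (h : DualPair M V W) (hσ : IsTriangulatingIn V M σ)
    (hτ : IsTriangulatingIn W M✶ τ) {O : Set (Arc E)} (hO : IsOrientation O) :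
    ∃ O' ∈ compatibleIn V M σ ∩ compatibleIn W M✶ τ, ReversalEquiv V W O O' := by
  obtain ⟨r, hr, hcard⟩ := h.exists_representatives
  set Ω := compatibleIn V M σ ∩ compatibleIn W M✶ τ with hΩ
  have hinj : InjOn r Ω := by
    intro O₁ h₁ O₂ h₂ heq
    apply h.eq_of_reversalEquiv hσ hτ h₁ h₂
    have h3 := hr O₁ h₁.1.1
    rw [heq] at h3
    exact h3.trans (hr O₂ h₂.1.1).symm
  have hsub : r '' Ω ⊆ r '' {O | IsOrientation O} := image_mono fun O hO => hO.1.1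
  have hbases : {B | M.IsBase B}.ncard = Ω.ncard := by
    rw [hΩ, ← (h.bijOn_orientBasis hσ hτ).image_eq, (h.bijOn_orientBasis hσ hτ).injOn.ncard_image]
  -- Compatible orientations have distinct representatives and are as many as bases, while all
  -- representatives together are at most as many; so none is missed.
  have himg : r '' Ω = r '' {O | IsOrientation O} := by
    apply Set.eq_of_subset_of_ncard_le hsub _ (Set.toFinite _)
    rw [hinj.ncard_image, ← hbases]
    exact hcard
  obtain ⟨O', hO', heq⟩ : r O ∈ r '' Ω := himg ▸ mem_image_of_mem r hO
  refine ⟨O', hO', ?_⟩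
  have h1 := hr O hO
  rw [← heq] at h1
  exact h1.trans (hr O' hO'.1.1).symm

end Existence

end RegularMatroid

namespace RegularMatroid

/-! ### Injectivity of the extended map; independent sets -/

section ExtendedMap

variable {E : Type*} {V W : AddSubgroup (E → ℤ)} {M : Matroid E}
  {σ τ : Set (Set (Arc E))}

lemma IsVectorReversal.vec_eq_neg {O O' : Set (Arc E)} {u v : E → ℤ}
    (hr : IsVectorReversal V W O O' u v) (hO : IsOrientation O) {e : E} (he : u e ≠ 0) :
    vec O' e = -u e := by
  have h1 := (hr.left_sign.apply_eq_of_subset hO hr.left_subset e).resolve_left he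
  have h2 := (hr.eq_zero_or e).resolve_left he
  rw [hr.vec_eq hO]
  simp only [Pi.sub_apply, Pi.smul_apply, Pi.add_apply, smul_eq_mul]
  omega

variable [Fintype E]

/-- A signed circuit conformal to `u₂ - u₁` lies in the first external basis: where `u₁` is nonzero
its arcs are reversed arcs of `u₁`, hence in `O₁'`, and elsewhere its edges are in `B₁`.
Symmetrically its reverse lies in the second. -/
lemma DualPair.left_unique (h : DualPair M V W) (hσ : IsTriangulatingIn V M σ)
    {B₁ B₂ : Set E} (hB₁ : M.IsBase B₁) (hB₂ : M.IsBase B₂) {O₁ O₂ O₁' O₂' : Set (Arc E)}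
    {u₁ u₂ v₁ v₂ : E → ℤ} (hr₁ : IsVectorReversal V W O₁ O₁' u₁ v₁)
    (hr₂ : IsVectorReversal V W O₂ O₂' u₂ v₂) (hO₁ : O₁' ⊆ extBasis M σ B₁)
    (hO₂ : O₂' ⊆ extBasis M σ B₂) (h₁ : ∀ e, u₁ e ≠ 0 → u₂ e = 0 → e ∈ B₂)
    (h₂ : ∀ e, u₂ e ≠ 0 → u₁ e = 0 → e ∈ B₁) : u₁ = u₂ := by
  have hz : u₂ - u₁ = 0 := by
    apply h.eq_zero_of_forall (V.sub_mem hr₂.left_mem hr₁.left_mem)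
    intro C hC hpos
    have hval : ∀ b ∈ C, (u₁ b.1 = 0 ∨ u₁ b.1 = -b.2) ∧ (u₂ b.1 = 0 ∨ u₂ b.1 = b.2) ∧
        (u₁ b.1 ≠ 0 ∨ u₂ b.1 ≠ 0) := by
      intro b hb
      have := hpos b hb
      rw [Pi.sub_apply] at this
      rcases hr₁.left_sign b.1 with h3 | h3 | h3 <;> rcases hr₂.left_sign b.1 with h4 | h4 | h4 <;>
        rcases unit_int_cases b.2 with h5 | h5 <;> rw [h3, h4, h5] at this <;>
        simp [h3, h4, h5] at this ⊢
    refine hσ.not_subset hB₁ hB₂ hC (fun b hb => ?_) (opp_subset_iff.2 fun b hb => mem_opp.2 ?_)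
    · obtain ⟨h3, h4, h5⟩ := hval b hb
      by_cases h6 : u₁ b.1 = 0
      · exact mem_extBasis_of_mem (h₂ b.1 (h5.resolve_left (not_not.2 h6)) h6)
      · have h7 : b.opp ∈ signedArcs u₁ := by
          simpa [mem_signedArcs] using h3.resolve_left h6
        simpa using hO₁ (hr₁.opp_mem h7)
    · obtain ⟨h3, h4, h5⟩ := hval b hb
      by_cases h6 : u₂ b.1 = 0
      · exact mem_extBasis_of_mem (h₁ b.1 (h5.resolve_right (not_not.2 h6)) h6)
      · exact hO₂ (hr₂.opp_mem (h4.resolve_left h6))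
  exact (sub_eq_zero.1 hz).symm

/-- The orientation can be recovered from the value of the extended map. -/
theorem DualPair.extension_injective (h : DualPair M V W) (hσ : IsTriangulatingIn V M σ)
    (hτ : IsTriangulatingIn W M✶ τ) {B₁ B₂ : Set E} (hB₁ : M.IsBase B₁) (hB₂ : M.IsBase B₂)
    {O₁ O₂ : Set (Arc E)} (hO₁ : IsOrientation O₁) (hO₂ : IsOrientation O₂)
    {u₁ u₂ v₁ v₂ : E → ℤ} (hr₁ : IsVectorReversal V W O₁ (orientBasis M σ τ B₁) u₁ v₁)
    (hr₂ : IsVectorReversal V W O₂ (orientBasis M σ τ B₂) u₂ v₂)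
    (heq : (B₁ ∪ Function.support u₁) \ Function.support v₁ =
      (B₂ ∪ Function.support u₂) \ Function.support v₂) : O₁ = O₂ := by
  have hmem : ∀ e, ((e ∈ B₁ ∨ u₁ e ≠ 0) ∧ v₁ e = 0) ↔ ((e ∈ B₂ ∨ u₂ e ≠ 0) ∧ v₂ e = 0) := by
    intro e
    have := Set.ext_iff.1 heq e
    simpa only [mem_sdiff, mem_union, Function.mem_support, not_not] using this
  have hz₁ := hr₁.eq_zero_or
  have hz₂ := hr₂.eq_zero_or
  -- An edge of `u₁` is not in `v₁`, so it belongs to the common value; if it is not in `u₂`, it can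
  -- only come from `B₂`.
  have hu : u₁ = u₂ := by
    refine h.left_unique hσ hB₁ hB₂ hr₁ hr₂ inter_subset_left inter_subset_left ?_ ?_
    · intro e h1 h2
      have h3 := hmem e
      have h4 := hz₁ e
      tauto
    · intro e h1 h2
      have h3 := hmem e
      have h4 := hz₂ e
      tauto
  have hv : v₁ = v₂ := by
    refine h.symm.left_unique hτ (isBase_dual_compl h.ground_eq hB₁)
      (isBase_dual_compl h.ground_eq hB₂) hr₁.swap hr₂.swap inter_subset_right inter_subset_right
      ?_ ?_
    · intro e h1 h2 h5
      have h3 := hmem e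
      tauto
    · intro e h1 h2 h5
      have h3 := hmem e
      tauto
  subst hu hv
  have hor₁ := hr₁.isOrientation hO₁
  have hor₂ := hr₂.isOrientation hO₂
  have hB : B₁ = B₂ := by
    apply h.eq_of_agree hσ hτ hB₁ hB₂
    intro a ha
    -- With `u` and `v` shared, the bases can differ only on reversed edges, and there both final
    -- orientations are given by `-u` or `-v`.
    have h1 : u₁ a.1 ≠ 0 ∨ v₁ a.1 ≠ 0 := by
      have h3 := hmem a.1
      tauto
    rw [← hor₁.vec_eq_iff, ← hor₂.vec_eq_iff]
    rcases h1 with h1 | h1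
    · rw [hr₁.vec_eq_neg hO₁ h1, hr₂.vec_eq_neg hO₂ h1]
    · rw [hr₁.swap.vec_eq_neg hO₁ h1, hr₂.swap.vec_eq_neg hO₂ h1]
  subst hB
  rw [← hO₁.signedArcs_vec, ← hO₂.signedArcs_vec]
  congr 1
  have h1 := hr₁.vec_eq hO₁
  rw [hr₂.vec_eq hO₂] at h1
  exact (sub_left_injective h1).symm

/-- The vector `u₁ - u₂ = v₂ - v₁` lies in both groups, so it is orthogonal to itself. -/
lemma DualPair.reversal_unique (h : DualPair M V W) {O O' : Set (Arc E)} (hO : IsOrientation O)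
    {u₁ u₂ v₁ v₂ : E → ℤ} (hr₁ : IsVectorReversal V W O O' u₁ v₁)
    (hr₂ : IsVectorReversal V W O O' u₂ v₂) : u₁ = u₂ ∧ v₁ = v₂ := by
  have h1 := hr₁.vec_eq hO
  rw [hr₂.vec_eq hO] at h1
  have h2 : ∀ e, u₁ e - u₂ e = v₂ e - v₁ e := by
    intro e
    have := congrFun h1 e
    simp only [Pi.sub_apply, Pi.smul_apply, Pi.add_apply, smul_eq_mul] at this
    omega
  have h3 := h.orthogonal _ (V.sub_mem hr₁.left_mem hr₂.left_mem) _
    (W.sub_mem hr₂.right_mem hr₁.right_mem)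
  have h4 : ∀ e, u₁ e - u₂ e = 0 := by
    intro e
    have h5 : ∀ e ∈ Finset.univ, 0 ≤ (u₁ - u₂) e * (v₂ - v₁) e := by
      intro e _
      simp only [Pi.sub_apply, h2]
      exact mul_self_nonneg _
    have := (Finset.sum_eq_zero_iff_of_nonneg h5).1 h3 e (Finset.mem_univ _)
    simp only [Pi.sub_apply, ← h2, mul_self_eq_zero] at this
    exact this
  constructor
  · ext e
    have := h4 e
    omega
  · ext e
    have := h4 e
    have := h2 e
    omega

/-- A common edge would carry a common arc, and orthogonality would then give an edge on which `C`
and `D` disagree, impossible inside one orientation. -/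
lemma DualPair.disjoint_edges (h : DualPair M V W) {C D O : Set (Arc E)} (hO : IsOrientation O)
    (hC : IsSignedIn V M C) (hD : IsSignedIn W M✶ D) (hCO : C ⊆ O) (hDO : D ⊆ O) :
    Disjoint (edges C) (edges D) := by
  rw [Set.disjoint_left]
  rintro _ ⟨a, ha, rfl⟩ ⟨b, hb, hab⟩
  rcases Arc.eq_or_eq_opp hab with rfl | rfl
  · obtain ⟨c, hc, hc'⟩ := h.exists_opp_mem hC hD ha hb
    exact hO.opp_notMem (hDO hc) (hCO hc')
  · exact hO.opp_notMem (hCO ha) (hDO hb)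

/-- Reversing cocircuits keeps an orientation compatible with a circuit signature. -/
lemma DualPair.mem_compatibleIn_of_left_eq_zero (h : DualPair M V W) {O O' : Set (Arc E)}
    {u v : E → ℤ} (hr : IsVectorReversal V W O O' u v) (hO : IsOrientation O)
    (hO' : O' ∈ compatibleIn V M σ) (hu : u = 0) : O ∈ compatibleIn V M σ := by
  refine ⟨hO, fun C hC hCO => hO'.2 C hC fun a ha => ?_⟩
  refine (hr.mem_iff (congrFun hu a.1) ?_).2 (hCO ha)
  -- Otherwise `C` would meet a signed cocircuit from the decomposition of `v`, which is also
  -- contained in `O`.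
  by_contra hne
  obtain ⟨S, hS, -, hSv⟩ := h.symm.exists_decomposition hr.right_mem hr.right_sign
  have h1 : a.1 ∈ edges (⋃₀ S) := by
    rw [hSv, edges_signedArcs hr.right_sign]
    exact hne
  obtain ⟨b, ⟨D, hDS, hb⟩, hba⟩ := h1
  have hDO : D ⊆ O := by
    refine Subset.trans ?_ hr.right_subset
    rw [← hSv]
    exact subset_sUnion_of_mem hDS
  exact Set.disjoint_left.1 (h.disjoint_edges hO hC (hS D hDS) hCO hDO) (fst_mem_edges ha)
    (hba ▸ fst_mem_edges hb)

/-- An independent set contains no nonempty union of circuits. -/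
lemma DualPair.left_eq_zero_of_indep (h : DualPair M V W) {u : E → ℤ} (hu : u ∈ V)
    (hs : IsSignVector u) {S : Set E} (hS : M.Indep S) (huS : Function.support u ⊆ S) :
    u = 0 := by
  obtain ⟨F, hF, -, hFu⟩ := h.exists_decomposition hu hs
  by_contra hne
  obtain ⟨e, he⟩ := Function.ne_iff.1 hne
  have h1 : e ∈ edges (⋃₀ F) := by
    rw [hFu, edges_signedArcs hs]
    exact he
  obtain ⟨a, ⟨C, hC, ha⟩, rfl⟩ := h1
  apply (hF C hC).isCircuit.not_indep
  refine hS.subset (Subset.trans ?_ huS)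
  rw [← edges_signedArcs hs, ← hFu]
  exact image_mono (subset_sUnion_of_mem hC)

end ExtendedMap

/-! ### From the matrix to orthogonal groups of integer vectors -/

section Matrices

variable {E m : Type*}

lemma arcsOf_intCast (w : E → ℤ) : arcsOf (fun e => (w e : ℝ)) = signedArcs w := by
  ext a
  simp only [arcsOf, mem_ofPred_eq, mem_signedArcs]
  exact_mod_cast Iff.rfl

lemma support_intCast (w : E → ℤ) :
    Function.support (fun e => (w e : ℝ)) = Function.support w := by
  ext e
  simp

lemma exists_intCast_eq {v : E → ℝ} (h : ∀ e, v e = 0 ∨ v e = 1 ∨ v e = -1) :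
    ∃ w : E → ℤ, IsSignVector w ∧ v = fun e => (w e : ℝ) := by
  have : ∀ e, ∃ n : ℤ, (n = 0 ∨ n = 1 ∨ n = -1) ∧ v e = n := by
    intro e
    rcases h e with h | h | h
    · exact ⟨0, by simp, by simpa using h⟩
    · exact ⟨1, by simp, by simpa using h⟩
    · exact ⟨-1, by simp, by simpa using h⟩
  choose w hw hw' using this
  exact ⟨w, hw, funext hw'⟩

lemma isSignVector_intCast {w : E → ℤ} (h : IsSignVector w) (e : E) :
    (w e : ℝ) = 0 ∨ (w e : ℝ) = 1 ∨ (w e : ℝ) = -1 := by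
  rcases h e with h | h | h <;> simp [h]

/-- The internal atlas is the external atlas of the dual matroid; this lets every circuit lemma
serve cocircuits. -/
lemma intBasis_eq {M : Matroid E} (hM : M.E = univ) (τ : Set (Set (Arc E))) (B : Set E) :
    intBasis M τ B = extBasis M✶ τ Bᶜ := by
  ext a
  simp only [intBasis, extBasis, mem_ofPred_eq, mem_compl_iff, not_not, Matroid.fundCocircuit,
    Matroid.dual_ground, hM, ← compl_eq_univ_sdiff]

lemma bby_eq_orientBasis {M : Matroid E} (hM : M.E = univ) (σ τ : Set (Set (Arc E))) :
    bby M σ τ = orientBasis M σ τ := by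
  ext1 B
  rw [bby, intBasis_eq hM, orientBasis]

section RowSpace

variable [Fintype m]

/-- The integer vectors in the row space of `A`. -/
def intRowSpace (A : Matrix m E ℝ) : AddSubgroup (E → ℤ) where
  carrier := {x | ∃ y : m → ℝ, Aᵀ *ᵥ y = fun e => (x e : ℝ)}
  zero_mem' := by
    refine ⟨0, ?_⟩
    ext e
    simp
  add_mem' := by
    rintro x y ⟨x', hx⟩ ⟨y', hy⟩
    refine ⟨x' + y', ?_⟩
    rw [mulVec_add, hx, hy]
    ext e
    simp
  neg_mem' := by
    rintro x ⟨x', hx⟩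
    refine ⟨-x', ?_⟩
    rw [mulVec_neg, hx]
    ext e
    simp

lemma isSignedCocircuit_iff {A : Matrix m E ℝ} {M : Matroid E} {D : Set (Arc E)} :
    IsSignedCocircuit A M D ↔ IsSignedIn (intRowSpace A) M✶ D := by
  constructor
  · rintro ⟨v, hv, hA, hc, rfl⟩
    obtain ⟨w, hw, rfl⟩ := exists_intCast_eq hv
    exact ⟨w, hA, hw, by rwa [support_intCast] at hc, arcsOf_intCast w⟩
  · rintro ⟨w, hA, hw, hc, rfl⟩
    exact ⟨fun e => (w e : ℝ), isSignVector_intCast hw, hA, by rwa [support_intCast],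
      (arcsOf_intCast w).symm⟩

lemma IsCocircuitSignature.isTriangulatingIn {A : Matrix m E ℝ} {M : Matroid E}
    {τ : Set (Set (Arc E))} (hM : M.E = univ) (hτ : IsCocircuitSignature A M τ)
    (hτt : IsCoTriangulating A M τ) : IsTriangulatingIn (intRowSpace A) M✶ τ where
  signed := fun C hC => isSignedCocircuit_iff.1 (hτ.signed C hC)
  existsUnique := hτ.existsUnique
  mem_of_subset := by
    intro B hB D hD hDB
    have hB' : M.IsBase Bᶜ := by
      have := isBase_dual_compl (M := M✶) hM hB
      rwa [Matroid.dual_dual] at this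
    refine hτt Bᶜ hB' D (isSignedCocircuit_iff.2 hD) ?_
    rwa [intBasis_eq hM, compl_compl]

lemma coCompatible_eq (A : Matrix m E ℝ) (M : Matroid E) (τ : Set (Set (Arc E))) :
    coCompatible A M τ = compatibleIn (intRowSpace A) M✶ τ := by
  ext O
  simp only [coCompatible, compatibleIn, isSignedCocircuit_iff]

end RowSpace

variable [Fintype E]

/-- The integer vectors in the kernel of `A`. -/
def intKer (A : Matrix m E ℝ) : AddSubgroup (E → ℤ) where
  carrier := {x | A *ᵥ (fun e => (x e : ℝ)) = 0}
  zero_mem' := by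
    have : (fun e : E => (((0 : E → ℤ) e : ℤ) : ℝ)) = 0 := by
      ext e
      simp
    simp only [mem_ofPred_eq]
    rw [this, mulVec_zero]
  add_mem' := by
    intro x y hx hy
    have : (fun e : E => (((x + y) e : ℤ) : ℝ)) = (fun e => (x e : ℝ)) + fun e => (y e : ℝ) := by
      ext e
      simp
    simp only [mem_ofPred_eq] at hx hy ⊢
    rw [this, mulVec_add, hx, hy, add_zero]
  neg_mem' := by
    intro x hx
    have : (fun e : E => (((-x) e : ℤ) : ℝ)) = -fun e => (x e : ℝ) := by
      ext e
      simp
    simp only [mem_ofPred_eq] at hx ⊢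
    rw [this, mulVec_neg, hx, neg_zero]

lemma isSignedCircuit_iff {A : Matrix m E ℝ} {M : Matroid E} {C : Set (Arc E)} :
    IsSignedCircuit A M C ↔ IsSignedIn (intKer A) M C := by
  constructor
  · rintro ⟨v, hv, hA, hc, rfl⟩
    obtain ⟨w, hw, rfl⟩ := exists_intCast_eq hv
    exact ⟨w, hA, hw, by rwa [support_intCast] at hc, arcsOf_intCast w⟩
  · rintro ⟨w, hA, hw, hc, rfl⟩
    exact ⟨fun e => (w e : ℝ), isSignVector_intCast hw, hA, by rwa [support_intCast],
      (arcsOf_intCast w).symm⟩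

lemma IsCircuitSignature.isTriangulatingIn {A : Matrix m E ℝ} {M : Matroid E}
    {σ : Set (Set (Arc E))} (hσ : IsCircuitSignature A M σ) (hσt : IsTriangulating A M σ) :
    IsTriangulatingIn (intKer A) M σ where
  signed := fun C hC => isSignedCircuit_iff.1 (hσ.signed C hC)
  existsUnique := hσ.existsUnique
  mem_of_subset := fun B hB C hC => hσt B hB C (isSignedCircuit_iff.2 hC)

lemma compatible_eq (A : Matrix m E ℝ) (M : Matroid E) (σ : Set (Set (Arc E))) :
    compatible A M σ = compatibleIn (intKer A) M σ := by
  ext O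
  simp only [compatible, compatibleIn, isSignedCircuit_iff]

variable [Fintype m]

lemma sum_intKer_mul_intRowSpace (A : Matrix m E ℝ) {x y : E → ℤ} (hx : x ∈ intKer A)
    (hy : y ∈ intRowSpace A) : ∑ e, x e * y e = 0 := by
  obtain ⟨z, hz⟩ := hy
  have hx' : A *ᵥ (fun e => (x e : ℝ)) = 0 := hx
  have h1 : (fun e => (x e : ℝ)) ⬝ᵥ (fun e => (y e : ℝ)) = 0 := by
    rw [← hz, mulVec_transpose, dotProduct_comm, ← dotProduct_mulVec, hx', dotProduct_zero]
  have h2 : ((∑ e, x e * y e : ℤ) : ℝ) = 0 := by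
    rw [← h1]
    simp [dotProduct]
  exact_mod_cast h2

/-- A matrix with a circuit and a cocircuit signature gives a dual pair. Total unimodularity enters
only through the existence of signatures, which provide a `{0, 1, -1}`-vector for each circuit and
each cocircuit. -/
lemma dualPair_of_signatures {A : Matrix m E ℝ} {M : Matroid E} {σ τ : Set (Set (Arc E))}
    (hM : M.E = univ) (hσ : IsCircuitSignature A M σ) (hτ : IsCocircuitSignature A M τ) :
    DualPair M (intKer A) (intRowSpace A) where
  ground_eq := hM
  orthogonal := fun _ hx _ hy => sum_intKer_mul_intRowSpace A hx hy
  exists_circuit := by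
    intro X hX
    obtain ⟨C, ⟨hC, hCX⟩, -⟩ := hσ.existsUnique X hX
    exact ⟨C, isSignedCircuit_iff.1 (hσ.signed C hC), hCX⟩
  exists_cocircuit := by
    intro X hX
    obtain ⟨C, ⟨hC, hCX⟩, -⟩ := hτ.existsUnique X hX
    exact ⟨C, isSignedCocircuit_iff.1 (hτ.signed C hC), hCX⟩

lemma IsReversal.exists_isVectorReversal {A : Matrix m E ℝ} {M : Matroid E}
    {O O' : Set (Arc E)} {𝒞 𝒟 : Set (Set (Arc E))} (h : IsReversal A M O 𝒞 𝒟 O') :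
    ∃ u v, IsVectorReversal (intKer A) (intRowSpace A) O O' u v ∧
      edges (⋃₀ 𝒞) = Function.support u ∧ edges (⋃₀ 𝒟) = Function.support v := by
  obtain ⟨u, hu, hus, hua⟩ := exists_vector_of_family (Set.toFinite 𝒞)
    (fun C hC => isSignedCircuit_iff.1 (h.circuit C hC).1) h.disjoint_circuits
  obtain ⟨v, hv, hvs, hva⟩ := exists_vector_of_family (Set.toFinite 𝒟)
    (fun C hC => isSignedCocircuit_iff.1 (h.cocircuit C hC).1) h.disjoint_cocircuits
  have hue : edges (⋃₀ 𝒞) = Function.support u := by rw [← hua, edges_signedArcs hus]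
  have hve : edges (⋃₀ 𝒟) = Function.support v := by rw [← hva, edges_signedArcs hvs]
  refine ⟨u, v, ⟨hu, hv, hus, hvs, fun e => ?_, ?_, ?_, ?_⟩, hue, hve⟩
  · by_contra! hne
    have h1 : e ∈ edges (⋃₀ 𝒞) := hue ▸ hne.1
    have h2 : e ∈ edges (⋃₀ 𝒟) := hve ▸ hne.2
    obtain ⟨a, ⟨C, hC, ha⟩, rfl⟩ := h1
    obtain ⟨b, ⟨D, hD, hb⟩, hab⟩ := h2
    exact Set.disjoint_left.1 (h.disjoint_circuit_cocircuit C hC D hD) (fst_mem_edges ha)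
      (hab ▸ fst_mem_edges hb)
  · rw [hua]
    exact sUnion_subset fun C hC => (h.circuit C hC).2
  · rw [hva]
    exact sUnion_subset fun C hC => (h.cocircuit C hC).2
  · rw [hua, hva]
    exact h.eq

lemma IsVectorReversal.exists_isReversal {A : Matrix m E ℝ} {M : Matroid E}
    (hd : DualPair M (intKer A) (intRowSpace A)) {O O' : Set (Arc E)} {u v : E → ℤ}
    (h : IsVectorReversal (intKer A) (intRowSpace A) O O' u v) :
    ∃ 𝒞 𝒟, IsReversal A M O 𝒞 𝒟 O' := by
  obtain ⟨S, hS, hSd, hSu⟩ := hd.exists_decomposition h.left_mem h.left_sign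
  obtain ⟨T, hT, hTd, hTv⟩ := hd.symm.exists_decomposition h.right_mem h.right_sign
  have hSO : ∀ C ∈ S, C ⊆ signedArcs u := fun C hC => hSu ▸ subset_sUnion_of_mem hC
  have hTO : ∀ D ∈ T, D ⊆ signedArcs v := fun D hD => hTv ▸ subset_sUnion_of_mem hD
  refine ⟨S, T, ⟨fun C hC => ⟨isSignedCircuit_iff.2 (hS C hC), (hSO C hC).trans h.left_subset⟩,
    fun D hD => ⟨isSignedCocircuit_iff.2 (hT D hD), (hTO D hD).trans h.right_subset⟩,
    hSd, hTd, fun C hC D hD => ?_, ?_⟩⟩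
  · rw [Set.disjoint_left]
    intro e h1 h2
    have h3 : e ∈ Function.support u := edges_signedArcs h.left_sign ▸ image_mono (hSO C hC) h1
    have h4 : e ∈ Function.support v := edges_signedArcs h.right_sign ▸ image_mono (hTO D hD) h2
    rcases h.eq_zero_or e with h5 | h5
    · exact h3 h5
    · exact h4 h5
  · rw [hSu, hTv]
    exact h.eq

end Matrices

end RegularMatroid

/-! ### The main theorem -/

theorem theorem1p16 {E m : Type*} [Fintype E] [Fintype m]
    (A : Matrix m E ℝ) (M : Matroid E) (hA : IsTURepresentation A M)
    (σ τ : Set (Set (Arc E)))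
    (hσ : IsCircuitSignature A M σ)
    (hτ : IsCocircuitSignature A M τ)
    (hσt : IsTriangulating A M σ)
    (hτt : IsCoTriangulating A M τ) :
    -- the map is well defined: the compatible orientation `O'` exists and is unique, the BBY map
    -- can be inverted at `O'`, and the value does not depend on the reversed families
    Set.BijOn (bby M σ τ) {B | M.IsBase B}
      (compatible A M σ ∩ coCompatible A M τ) ∧
    (∀ O, IsOrientation O →
      ∃! O', O' ∈ compatible A M σ ∩ coCompatible A M τ ∧
        ∃ 𝒞 𝒟, IsReversal A M O 𝒞 𝒟 O') ∧
    (∀ O, IsOrientation O →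
      ∀ O' 𝒞 𝒟 B, IsExtensionData A M σ τ O O' 𝒞 𝒟 B →
        extMap A M σ τ O =
          (B ∪ edges (⋃₀ 𝒞)) \ edges (⋃₀ 𝒟)) ∧
    -- (1)
    Set.BijOn (extMap A M σ τ) {O | IsOrientation O} Set.univ ∧
    -- (2)
    (Set.BijOn (extMap A M σ τ) (compatible A M σ)
        {S | M.Indep S} ∧
      ∀ O ∈ compatible A M σ,
        ∀ O' 𝒞 𝒟 B, IsExtensionData A M σ τ O O' 𝒞 𝒟 B →
          extMap A M σ τ O = B \ edges (⋃₀ 𝒟)) ∧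
    -- (3)
    (Set.BijOn (extMap A M σ τ) (coCompatible A M τ)
        {S | M.Spanning S} ∧
      ∀ O ∈ coCompatible A M τ,
        ∀ O' 𝒞 𝒟 B, IsExtensionData A M σ τ O O' 𝒞 𝒟 B →
          extMap A M σ τ O = B ∪ edges (⋃₀ 𝒞)) := by
  have hM := hA.ground_eq
  have hd := dualPair_of_signatures hM hσ hτ
  have hσ' := hσ.isTriangulatingIn hσt
  have hτ' := hτ.isTriangulatingIn hM hτt
  have hbij : Set.BijOn (bby M σ τ) {B | M.IsBase B} (compatible A M σ ∩ coCompatible A M τ) := by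
    rw [bby_eq_orientBasis hM, compatible_eq, coCompatible_eq]
    exact hd.bijOn_orientBasis hσ' hτ'
  have huniq : ∀ O, IsOrientation O → ∃! O', O' ∈ compatible A M σ ∩ coCompatible A M τ ∧
      ∃ 𝒞 𝒟, IsReversal A M O 𝒞 𝒟 O' := by
    intro O hO
    rw [compatible_eq, coCompatible_eq]
    obtain ⟨O', hO', hequiv⟩ := hd.exists_reversalEquiv hσ' hτ' hO
    obtain ⟨u, hu, v, hv, heq⟩ := id hequiv
    refine ⟨O', ⟨hO', (hd.isVectorReversal hO hO'.1.1 hu hv heq).exists_isReversal hd⟩, ?_⟩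
    rintro O'' ⟨hO'', 𝒞, 𝒟, hrev⟩
    obtain ⟨u', v', hr', -⟩ := hrev.exists_isVectorReversal
    exact hd.eq_of_reversalEquiv hσ' hτ' hO'' hO' ((hr'.reversalEquiv hO).symm.trans hequiv)
  have hdata : ∀ O, IsOrientation O → ∃ O' 𝒞 𝒟 B, IsExtensionData A M σ τ O O' 𝒞 𝒟 B := by
    intro O hO
    obtain ⟨O', ⟨hO', 𝒞, 𝒟, hrev⟩, -⟩ := huniq O hO
    obtain ⟨B, hB, hBO⟩ := hbij.surjOn hO'
    exact ⟨O', 𝒞, 𝒟, B, hO', hrev, hB, hBO⟩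
  have hvalue : ∀ O, IsOrientation O → ∀ O' 𝒞 𝒟 B, IsExtensionData A M σ τ O O' 𝒞 𝒟 B →
      extMap A M σ τ O = (B ∪ edges (⋃₀ 𝒞)) \ edges (⋃₀ 𝒟) := by
    intro O hO O' 𝒞 𝒟 B hD
    obtain ⟨O₁, 𝒞₁, 𝒟₁, B₁, hD₁, hS⟩ := Classical.epsilon_spec
      (p := fun S : Set E => ∃ O' 𝒞 𝒟 B, IsExtensionData A M σ τ O O' 𝒞 𝒟 B ∧
        S = (B ∪ edges (⋃₀ 𝒞)) \ edges (⋃₀ 𝒟)) ⟨_, O', 𝒞, 𝒟, B, hD, rfl⟩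
    have hO' : O₁ = O' := (huniq O hO).unique ⟨hD₁.compatible, 𝒞₁, 𝒟₁, hD₁.reversal⟩
      ⟨hD.compatible, 𝒞, 𝒟, hD.reversal⟩
    subst hO'
    have hB : B₁ = B := hbij.injOn hD₁.isBase hD.isBase (hD₁.bby_eq.trans hD.bby_eq.symm)
    subst hB
    obtain ⟨u₁, v₁, hr₁, hu₁, hv₁⟩ := hD₁.reversal.exists_isVectorReversal
    obtain ⟨u, v, hr, hu, hv⟩ := hD.reversal.exists_isVectorReversal
    -- The reversed families may differ, but their unions are the supports of uniquely determined
    -- vectors.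
    obtain ⟨rfl, rfl⟩ := hd.reversal_unique hO hr₁ hr
    rw [hu, hv, ← hu₁, ← hv₁]
    exact hS
  have hvec : ∀ O, IsOrientation O → ∃ B u v, M.IsBase B ∧
      IsVectorReversal (intKer A) (intRowSpace A) O (orientBasis M σ τ B) u v ∧
      extMap A M σ τ O = (B ∪ Function.support u) \ Function.support v := by
    intro O hO
    obtain ⟨O', 𝒞, 𝒟, B, hD⟩ := hdata O hO
    obtain ⟨u, v, hr, hu, hv⟩ := hD.reversal.exists_isVectorReversal
    refine ⟨B, u, v, hD.isBase, ?_, ?_⟩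
    · rw [← bby_eq_orientBasis hM, hD.bby_eq]
      exact hr
    · rw [hvalue O hO O' 𝒞 𝒟 B hD, hu, hv]
  have hinj : Set.InjOn (extMap A M σ τ) {O | IsOrientation O} := by
    intro O₁ hO₁ O₂ hO₂ heq
    obtain ⟨B₁, u₁, v₁, hB₁, hr₁, he₁⟩ := hvec O₁ hO₁
    obtain ⟨B₂, u₂, v₂, hB₂, hr₂, he₂⟩ := hvec O₂ hO₂
    exact hd.extension_injective hσ' hτ' hB₁ hB₂ hO₁ hO₂ hr₁ hr₂ (he₁.symm.trans (heq.trans he₂))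
  have hsurj : Set.SurjOn (extMap A M σ τ) {O | IsOrientation O} Set.univ := by
    classical
    -- Subsets inject into orientations, so the composite with the extended map is an injective
    -- self-map of a finite type and hence onto.
    let g : Set E → Set (Arc E) := fun S => signedArcs fun e => if e ∈ S then 1 else -1
    have hg : ∀ S, IsOrientation (g S) := fun S => isOrientation_signedArcs fun e => by
      by_cases he : e ∈ S <;> simp [he]
    have hginj : Function.Injective g := by
      intro S T hST
      ext e
      have h1 := Set.ext_iff.1 hST (e, 1)
      simp only [g, mem_signedArcs] at h1
      by_cases hS : e ∈ S <;> by_cases hT : e ∈ T <;> simp [hS, hT] at h1 ⊢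
    have hcomp : Function.Injective fun S => extMap A M σ τ (g S) := fun S T hST =>
      hginj (hinj (hg S) (hg T) hST)
    intro S _
    obtain ⟨T, hT⟩ := Finite.surjective_of_injective hcomp S
    exact ⟨g T, hg T, hT⟩
  have hleft : ∀ O ∈ compatible A M σ, ∀ O' u v, O' ∈ compatible A M σ →
      IsVectorReversal (intKer A) (intRowSpace A) O O' u v → u = 0 := by
    rw [compatible_eq]
    exact fun O hO O' u v hO' hr => hd.left_eq_zero hσ' hr hO hO'
  have hright : ∀ O ∈ coCompatible A M τ, ∀ O' u v, O' ∈ coCompatible A M τ →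
      IsVectorReversal (intKer A) (intRowSpace A) O O' u v → v = 0 := by
    rw [coCompatible_eq]
    exact fun O hO O' u v hO' hr => hd.symm.left_eq_zero hτ' hr.swap hO hO'
  have hmem : ∀ B, M.IsBase B → orientBasis M σ τ B ∈ compatible A M σ ∩ coCompatible A M τ := by
    rw [compatible_eq, coCompatible_eq]
    exact fun B hB => hd.orientBasis_mem hσ' hτ' hB
  refine ⟨hbij, huniq, hvalue, ⟨fun _ _ => Set.mem_univ _, hinj, hsurj⟩, ⟨⟨?_, ?_, ?_⟩, ?_⟩,
    ⟨⟨?_, ?_, ?_⟩, ?_⟩⟩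
  · intro O hO
    obtain ⟨B, u, v, hB, hr, he⟩ := hvec O hO.1
    have hu := hleft O hO _ u v (hmem B hB).1 hr
    refine hB.indep.subset ?_
    rw [he, hu]
    simp
  · exact hinj.mono fun O hO => hO.1
  · intro S hS
    obtain ⟨O, hO, rfl⟩ := hsurj (Set.mem_univ S)
    obtain ⟨B, u, v, hB, hr, he⟩ := hvec O hO
    refine ⟨O, ?_, rfl⟩
    -- The support of `u` is disjoint from that of `v`, so it survives in the value, and an
    -- independent set contains no circuit.
    have hu : u = 0 := by
      refine hd.left_eq_zero_of_indep hr.left_mem hr.left_sign hS fun e hue => ?_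
      rw [he]
      exact ⟨Or.inr hue, not_not.2 ((hr.eq_zero_or e).resolve_left hue)⟩
    rw [compatible_eq]
    refine hd.mem_compatibleIn_of_left_eq_zero hr hO ?_ hu
    rw [← compatible_eq]
    exact (hmem B hB).1
  · intro O hO O' 𝒞 𝒟 B hD
    obtain ⟨u, v, hr, hu, -⟩ := hD.reversal.exists_isVectorReversal
    have hu0 := hleft O hO O' u v hD.compatible.1 hr
    rw [hvalue O hO.1 O' 𝒞 𝒟 B hD, hu, hu0]
    simp
  · intro O hO
    obtain ⟨B, u, v, hB, hr, he⟩ := hvec O hO.1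
    have hv := hright O hO _ u v (hmem B hB).2 hr
    refine hB.spanning.superset ?_ (by simp [hM])
    rw [he, hv]
    simp
  · exact hinj.mono fun O hO => hO.1
  · intro S hS
    obtain ⟨O, hO, rfl⟩ := hsurj (Set.mem_univ S)
    obtain ⟨B, u, v, hB, hr, he⟩ := hvec O hO
    refine ⟨O, ?_, rfl⟩
    -- Dually, the support of `v` lies in the complement of the value, which is coindependent.
    have hv : v = 0 := by
      have hco : M✶.Indep (extMap A M σ τ O)ᶜ := by
        rw [Set.compl_eq_univ_sdiff, ← hM]
        exact (Matroid.spanning_iff_compl_coindep (by simp [hM])).1 hS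
      refine hd.symm.left_eq_zero_of_indep hr.right_mem hr.right_sign hco fun e hve => ?_
      rw [he]
      exact fun h => h.2 hve
    rw [coCompatible_eq]
    refine hd.symm.mem_compatibleIn_of_left_eq_zero hr.swap hO ?_ hv
    rw [← coCompatible_eq]
    exact (hmem B hB).2
  · intro O hO O' 𝒞 𝒟 B hD
    obtain ⟨u, v, hr, -, hv⟩ := hD.reversal.exists_isVectorReversal
    have hv0 := hright O hO O' u v hD.compatible.2 hr
    rw [hvalue O hO.1 O' 𝒞 𝒟 B hD, hv, hv0]
    simp
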